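/- Fix $m\ge 0$ and put $p=3m+2$. For every $n$, each node $j\in\{1,\dots,n\}$ carries $m$ fixed feature vectors $v_{jk}=v^{(n)}_{jk}\in\mathbb R^{r_k}$, $k=1,\dots,m$; let $w_k:\mathbb R^{r_k}\times\mathbb R^{r_k}\to\mathbb R$ be the similarity measures and $g_k:\mathbb R^{r_k}\to\mathbb R$ the nodal-effect functions. For $\theta=(\theta_1,\theta_2,\gamma,\zeta,\eta)\in\mathbb R^p$ with $\gamma,\zeta,\eta\in\mathbb R^m$, the random directed network $X\in\{0,1\}^{n\times n}$ with zero diagonal has law $P_\theta(X=x)=\exp\{\theta^\top s(x)\}/z(\theta)$, where $z(\theta)$ is the normalizing constant and $$\theta^\top s(x)=\theta_1\sum_{i<j}x_{ij}x_{ji}+\theta_2\sum_{i\ne j}x_{ij}+\sum_{k=1}^m\Big\{\gamma_k\sum_{i<j}(x_{ij}+x_{ji})\,w_k(v_{ik},v_{jk})+\zeta_k\sum_{i\ne j}x_{ij}\,g_k(v_{ik})+\eta_k\sum_{i\ne j}x_{ij}\,g_k(v_{jk})\Big\}.$$ Under this law the $N=n(n-1)/2$ dyads $D_{ij}=(X_{ij},X_{ji})$,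 $i<j$, are independent; the log-likelihood is $\mathcal L(\theta)=\sum_{i<j}\log P_\theta(D_{ij}=(x_{ij},x_{ji}))$. Let $I_N(\theta)$ be $1/N$ times the sum over all dyads of their Fisher information matrices at $\theta$. Let $\Theta\subseteq\mathbb R^p$ and let the data come from a fixed $\theta_0$ in the interior of $\Theta$, with $\mathcal A=\{k:\theta_{0,k}\ne0\}$. Assume that, for some constants $c>0$ and $C$ and all large $n$, $u^\top I_N(\theta_0)u\ge c\|u\|^2$ for all $u\in\mathbb R^p$, and $$\frac1N\sum_{i<j}\sum_{k=1}^m\big\{|w_k(v_{ik},v_{jk})|^3+|g_k(v_{ik})|^3+|g_k(v_{jk})|^3\big\}\le C.$$ Let $\hat\theta_{MLE}$ be a maximizer of $\mathcal L$ over $\Theta$, let $w^{\rm ad}_k=1/|\hat\theta_{k,MLE}|$ (read as $\infty$ if $\hat\theta_{k,MLE}=0$, with $\infty\cdot0=0$), and for $\lambda\in\mathbb R$ let $\hat\theta_\lambda$ be a minimizer over $\Theta$ of $-\mathcal L(\theta)+\lambda\sum_{k=1}^p w^{\rm ad}_k|\theta_k|$ (arbitrary minimizers may be taken, and arbitrary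 values where none exists). Put $\hat{\mathcal A}_\lambda=\{k:\hat\theta_{\lambda,k}\ne0\}$, $\mathrm{DF}_\lambda=|\hat{\mathcal A}_\lambda|$, $$\mathrm{NBIC}_\lambda=-\frac1{\sqrt N}\mathcal L(\hat\theta_\lambda)+(\log N)\,\mathrm{DF}_\lambda,$$ $\Omega_-=\{\lambda\in\mathbb R:\mathcal A\not\subseteq\hat{\mathcal A}_\lambda\}$ and $\Omega_+=\{\lambda\in\mathbb R:\mathcal A\subsetneq\hat{\mathcal A}_\lambda\}$. Let $\lambda_N^\circ$ be any deterministic sequence with $c_1\log N\le\lambda_N^\circ\le c_2\log N$ for some constants $c_1,c_2>0$ and all large $N$. Then, as $n\to\infty$, $$P_{\theta_0}\Big(\inf_{\lambda\in\Omega_-\cup\Omega_+}\mathrm{NBIC}_\lambda>\mathrm{NBIC}_{\lambda_N^\circ}\Big)\to1$$ (the infimum over the empty set being $+\infty$). Consequently, minimizing NBIC selects consistently: with probability tending to $1$, for every set $S\subseteq\mathbb R$ of candidate values containing $\lambda_N^\circ$ (in particular for $S=\mathbb R$), every minimizer $\hat\lambda$ of $\mathrm{NBIC}$ over $S$ satisfies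 $\hat{\mathcal A}_{\hat\lambda}=\mathcal A$. -/

import Mathlib

open Filter Topology

/-- Index set of the `p = 3m + 2` coefficients `θ = (θ₁, θ₂, γ, ζ, η)`: reciprocity and density,
then the homophily effects `γ`, the out-edge effects `ζ` and the in-edge effects `η` of the
`m` groups of nodal features. -/
abbrev Coef (m : ℕ) : Type := Fin 2 ⊕ Fin m ⊕ Fin m ⊕ Fin m

/-- The vector with reciprocity entry `a`, density entry `b` and blocks `h`, `o`, `i`. -/
def coefVec {m : ℕ} (a b : ℝ) (h o i : Fin m → ℝ) : Coef m → ℝ :=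
  Sum.elim ![a, b] (Sum.elim h (Sum.elim o i))

/-- The `m` groups of nodal features: group `k` has dimension `r k`, pairwise similarity
measure `w k` (for homophily) and nodal-effect function `g k`. -/
structure FeatureGroups (m : ℕ) where
  r : Fin m → ℕ
  w : ∀ k, EuclideanSpace ℝ (Fin (r k)) → EuclideanSpace ℝ (Fin (r k)) → ℝ
  g : ∀ k, EuclideanSpace ℝ (Fin (r k)) → ℝ

/-- The feature vector `v_j = (v_{j1}, …, v_{jm})` of one node. -/
abbrev FeatureGroups.NodeFeatures {m : ℕ} (M : FeatureGroups m) : Type :=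
  ∀ k, EuclideanSpace ℝ (Fin (M.r k))

/-- Directed networks on `n` nodes without self-loops, as adjacency matrices. -/
abbrev Network (n : ℕ) : Type := {x : Fin n → Fin n → Bool // ∀ j, x j j = false}

/-- A Boolean as a real number, `0` or `1`. -/
def bit (b : Bool) : ℝ := if b then 1 else 0

/-- The pairs of nodes `j₁ < j₂`. -/
abbrev NodePair (n : ℕ) : Type := {e : Fin n × Fin n // e.1 < e.2}

/-- The number of dyads `N = n (n - 1) / 2`, as a real number. -/
noncomputable def numDyads (n : ℕ) : ℝ := (n : ℝ) * ((n : ℝ) - 1) / 2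

section Model

variable {m : ℕ} (M : FeatureGroups m) {n : ℕ} (v : Fin n → M.NodeFeatures)

/-- The network statistics `s(x, V)`. Both edges of a dyad carry its homophily measure. -/
noncomputable def networkStat (x : Network n) : Coef m → ℝ :=
  coefVec
    (∑ j₁, ∑ j₂, if j₁ < j₂ then bit (x.1 j₁ j₂) * bit (x.1 j₂ j₁) else 0)
    (∑ j₁, ∑ j₂, if j₁ ≠ j₂ then bit (x.1 j₁ j₂) else 0)
    (fun k => ∑ j₁, ∑ j₂, if j₁ < j₂ then
      (bit (x.1 j₁ j₂) + bit (x.1 j₂ j₁)) * M.w k (v j₁ k) (v j₂ k) else 0)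
    (fun k => ∑ j₁, ∑ j₂, if j₁ ≠ j₂ then bit (x.1 j₁ j₂) * M.g k (v j₁ k) else 0)
    (fun k => ∑ j₁, ∑ j₂, if j₁ ≠ j₂ then bit (x.1 j₁ j₂) * M.g k (v j₂ k) else 0)

/-- The model: `P(X = x | θ; V) = exp (θᵀ s(x, V)) / z(θ; V)`. -/
noncomputable def networkProb (θ : Coef m → ℝ) (x : Network n) : ℝ :=
  Real.exp (θ ⬝ᵥ networkStat M v x) / ∑ x' : Network n, Real.exp (θ ⬝ᵥ networkStat M v x')

open Classical in
/-- The probability of an event about the random network under the model. -/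
noncomputable def eventProb (θ : Coef m → ℝ) (E : Set (Network n)) : ℝ :=
  ∑ x : Network n, if x ∈ E then networkProb M v θ x else 0

/-- The dyad `(x_{j₁j₂}, x_{j₂j₁})`. -/
def dyadOf (x : Network n) (e : NodePair n) : Bool × Bool :=
  (x.1 e.1.1 e.1.2, x.1 e.1.2 e.1.1)

/-- The exponent of the probability of dyad value `d` is `θᵀ (dyadStat d)`, relative to the
empty dyad. -/
noncomputable def dyadStat (e : NodePair n) (d : Bool × Bool) : Coef m → ℝ :=
  coefVec
    (bit d.1 * bit d.2)
    (bit d.1 + bit d.2)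
    (fun k => (bit d.1 + bit d.2) * M.w k (v e.1.1 k) (v e.1.2 k))
    (fun k => bit d.1 * M.g k (v e.1.1 k) + bit d.2 * M.g k (v e.1.2 k))
    (fun k => bit d.1 * M.g k (v e.1.2 k) + bit d.2 * M.g k (v e.1.1 k))

/-- `P(D_{j₁j₂} = d | θ)`; the denominator is `T₁₁ + T₁₀ + T₀₁ + 1`. -/
noncomputable def dyadProb (θ : Coef m → ℝ) (e : NodePair n) (d : Bool × Bool) : ℝ :=
  Real.exp (θ ⬝ᵥ dyadStat M v e d) / ∑ d' : Bool × Bool, Real.exp (θ ⬝ᵥ dyadStat M v e d')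

/-- The log-likelihood `ℒ(θ)` of the observed network `x`. -/
noncomputable def logLik (θ : Coef m → ℝ) (x : Network n) : ℝ :=
  ∑ e : NodePair n, Real.log (dyadProb M v θ e (dyadOf x e))

/-- The score of one dyad, `∇_θ log P(D_{j₁j₂} = d | θ)`. -/
noncomputable def dyadScore (θ : Coef m → ℝ) (e : NodePair n) (d : Bool × Bool) : Coef m → ℝ :=
  dyadStat M v e d - ∑ d' : Bool × Bool, dyadProb M v θ e d' • dyadStat M v e d'

/-- The Fisher information per dyad, averaged over the `N` dyads. -/
noncomputable def fisherInfo (θ : Coef m → ℝ) : Matrix (Coef m) (Coef m) ℝ :=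
  (numDyads n)⁻¹ • ∑ e : NodePair n, ∑ d : Bool × Bool,
    dyadProb M v θ e d • Matrix.vecMulVec (dyadScore M v θ e d) (dyadScore M v θ e d)

/-- `∑ (|w|³ + |g|³ + |g|³)` over all dyads and all feature groups. -/
noncomputable def thirdMoment : ℝ :=
  ∑ e : NodePair n, ∑ k : Fin m,
    (|M.w k (v e.1.1 k) (v e.1.2 k)| ^ 3 + |M.g k (v e.1.1 k)| ^ 3 + |M.g k (v e.1.2 k)| ^ 3)

/-- `θ` maximizes the likelihood over `Θ`, provided that the maximum is attained at all. -/
def IsMLE (Θ : Set (Coef m → ℝ)) (x : Network n) (θ : Coef m → ℝ) : Prop :=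
  (∃ θ' ∈ Θ, IsMaxOn (fun t => logLik M v t x) Θ θ') →
    θ ∈ Θ ∧ IsMaxOn (fun t => logLik M v t x) Θ θ

/-- `∑ₖ wₖ |θₖ|` with `wₖ = 1 / |mleₖ|`, where `wₖ = ∞` if `mleₖ = 0`, and `∞ · 0 = 0`. -/
noncomputable def adaptivePenalty (mle θ : Coef m → ℝ) : ENNReal :=
  ∑ k, (ENNReal.ofReal |mle k|)⁻¹ * ENNReal.ofReal |θ k|

/-- The penalized criterion `-ℒ(θ) + lam ∑ₖ wₖ |θₖ|`. -/
noncomputable def penalizedCriterion (mle : Coef m → ℝ) (lam : ℝ) (x : Network n)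
    (θ : Coef m → ℝ) : EReal :=
  ((-logLik M v θ x : ℝ) : EReal) + (lam : EReal) * (adaptivePenalty mle θ : EReal)

/-- `θ` minimizes the penalized criterion over `Θ`, provided that the minimum is attained
at all. -/
def IsRMLE (Θ : Set (Coef m → ℝ)) (mle : Coef m → ℝ) (lam : ℝ) (x : Network n)
    (θ : Coef m → ℝ) : Prop :=
  (∃ θ' ∈ Θ, IsMinOn (penalizedCriterion M v mle lam x) Θ θ') →
    θ ∈ Θ ∧ IsMinOn (penalizedCriterion M v mle lam x) Θ θ

/-- The set of nonzero coefficients. -/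
noncomputable def activeSet (θ : Coef m → ℝ) : Finset (Coef m) :=
  Finset.univ.filter fun k => θ k ≠ 0

/-- The network Bayesian information criterion at the estimate `est lam` on the data `x`. -/
noncomputable def nbic (x : Network n) (est : ℝ → Coef m → ℝ) (lam : ℝ) : ℝ :=
  -(1 / Real.sqrt (numDyads n)) * logLik M v (est lam) x
    + Real.log (numDyads n) * ((activeSet (est lam)).card : ℝ)

/-- The underfitting tuning parameters `Ω₋`. -/
def underfit (θ₀ : Coef m → ℝ) (est : ℝ → Coef m → ℝ) : Set ℝ :=
  {lam | ¬ activeSet θ₀ ⊆ activeSet (est lam)}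

/-- The overfitting tuning parameters `Ω₊`. -/
def overfit (θ₀ : Coef m → ℝ) (est : ℝ → Coef m → ℝ) : Set ℝ :=
  {lam | activeSet θ₀ ⊆ activeSet (est lam) ∧ activeSet (est lam) ≠ activeSet θ₀}

end Model

section Bridge
variable {m : ℕ} (M : FeatureGroups m) {n : ℕ} (v : Fin n → M.NodeFeatures)

lemma sum_lt_eq (f : Fin n → Fin n → ℝ) :
    (∑ j₁, ∑ j₂, if j₁ < j₂ then f j₁ j₂ else 0) = ∑ e : NodePair n, f e.1.1 e.1.2 := by
  rw [← Fintype.sum_prod_type' (f := fun a b => if a < b then f a b else 0),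
    ← Finset.sum_filter]
  exact (Finset.sum_subtype (p := fun e : Fin n × Fin n => e.1 < e.2) _ (by simp) (fun e => f e.1 e.2))

lemma sum_ne_eq (f : Fin n → Fin n → ℝ) :
    (∑ j₁, ∑ j₂, if j₁ ≠ j₂ then f j₁ j₂ else 0)
      = ∑ e : NodePair n, (f e.1.1 e.1.2 + f e.1.2 e.1.1) := by
  rw [← sum_lt_eq (fun a b => f a b + f b a)]
  have h : ∀ a b : Fin n, (if a ≠ b then f a b else 0)
      = (if a < b then f a b else 0) + (if b < a then f a b else 0) := by
    intro a b
    rcases lt_trichotomy a b with h | h | h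
    · simp [h, h.ne, h.not_gt]
    · simp [h]
    · simp [h, h.ne', h.not_gt]
  have h2 : ∀ a b : Fin n, (if a < b then f a b + f b a else 0)
      = (if a < b then f a b else 0) + (if a < b then f b a else 0) := by
    intro a b; split_ifs <;> simp
  simp only [h, h2, Finset.sum_add_distrib]
  congr 1
  rw [Finset.sum_comm]

lemma networkStat_eq (x : Network n) :
    networkStat M v x = ∑ e : NodePair n, dyadStat M v e (dyadOf x e) := by
  funext k
  rw [Finset.sum_apply]
  unfold networkStat dyadStat coefVec dyadOf
  rcases k with k | k | k | k
  · fin_cases k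
    · simp [sum_lt_eq]
    · simpa using sum_ne_eq (fun a b => bit (x.1 a b))
  · simp only [Sum.elim_inr]
    exact sum_lt_eq (fun a b => (bit (x.1 a b) + bit (x.1 b a)) * M.w k (v a k) (v b k))
  · simp only [Sum.elim_inr]
    exact sum_ne_eq (fun a b => bit (x.1 a b) * M.g k (v a k))
  · simp only [Sum.elim_inr]
    exact sum_ne_eq (fun a b => bit (x.1 a b) * M.g k (v b k))

lemma dyadOf_bijective : Function.Bijective (fun (x : Network n) (e : NodePair n) => dyadOf x e) := by
  constructor
  · intro x y h
    apply Subtype.ext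
    funext a b
    rcases lt_trichotomy a b with hab | hab | hab
    · have := congrFun h ⟨(a, b), hab⟩
      simp only [dyadOf, Prod.mk.injEq] at this
      exact this.1
    · subst hab; rw [x.2, y.2]
    · have := congrFun h ⟨(b, a), hab⟩
      simp only [dyadOf, Prod.mk.injEq] at this
      exact this.2
  · intro d
    refine ⟨⟨fun a b => if h : a < b then (d ⟨(a, b), h⟩).1
      else if h : b < a then (d ⟨(b, a), h⟩).2 else false, fun j => by simp⟩, ?_⟩
    funext e
    obtain ⟨⟨a, b⟩, h⟩ := e
    have h' : a < b := h
    simp [dyadOf, h', h'.not_gt]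

/-- Under the model the dyads are independent, with the dyad probabilities above. -/
theorem networkProb_eq_prod (θ : Coef m → ℝ) (x : Network n) :
    networkProb M v θ x = ∏ e : NodePair n, dyadProb M v θ e (dyadOf x e) := by
  have key : ∀ y : Network n, Real.exp (θ ⬝ᵥ networkStat M v y)
      = ∏ e : NodePair n, Real.exp (θ ⬝ᵥ dyadStat M v e (dyadOf y e)) := by
    intro y
    rw [networkStat_eq, dotProduct_sum, Real.exp_sum]
  unfold networkProb dyadProb
  rw [Finset.prod_div_distrib, ← key]
  congr 1
  rw [Finset.prod_univ_sum, Fintype.piFinset_univ]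
  simp only [key]
  exact Function.Bijective.sum_comp dyadOf_bijective
    (fun d : NodePair n → Bool × Bool => ∏ e, Real.exp (θ ⬝ᵥ dyadStat M v e (d e)))

theorem logLik_eq (θ : Coef m → ℝ) (x : Network n) :
    logLik M v θ x = Real.log (networkProb M v θ x) := by
  rw [networkProb_eq_prod, Real.log_prod]
  · rfl
  · intro e _
    unfold dyadProb
    positivity

end Bridge

/-!
The model is an exponential family in its natural parameter, so all randomness in `ℒ(θ₀ + h)`
is linear in `h`: `ℒ(θ₀ + h) = ℒ(θ₀) + ⟪h, U⟫ - G(h)`, where `U` is the score at `θ₀` and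
`G(h) = ∑ log E exp ⟪h, score of a dyad⟫` does not depend on the data (`logLik_add`). Elementary
bounds for cumulant generating functions of bounded centred variables, with the Fisher
information for the variances and the third moments for the remainders, enclose `G(h)` between
multiples of `N ‖h‖²`, the lower bound only for small `h`. Since the dyads are independent, the
second moment of `U` is `O(N)`, and by Markov's inequality `|U| ≤ K √N` with probability at least
`1 - O(1 / K²)` (`one_sub_le_eventProb_networkScore`).

On that event everything else is deterministic (`IsPinchedConcave`, with `q = √N`). Concavity
extends the local quadratic upper bound to a linear one far away, so the maximum likelihood
estimator exists and is within `O(1 / √N)` of `θ₀`. The adaptive weights are then bounded on the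
true active set and at least of order `√N` off it. Hence for a tuning parameter of order `log N`,
which tends to infinity and is `o(√N)`, the penalized estimator exists, is within `O(1 / √N)` of
`θ₀`, and has no false positive: putting one to zero would save more penalty than the likelihood
it costs (`activeSet_eq_and_le_logLik`).

At the reference parameter the criterion is therefore at most
`-ℒ(θ₀) / √N + |𝒜| log N + O(1 / √N)`. Underfitting costs order `N` in likelihood, thus `√N` in
the criterion, for any coefficient vector with a missing coordinate. Overfitting gains at most
`sup ℒ - ℒ(θ₀) = O(1)` in likelihood and costs at least `log N` (`nbic_add_one_le`). No property
of the estimates at other tuning parameters is needed. The gap is uniform, so it passes to the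
infimum; and a minimizer over a set containing the reference parameter can lie neither among the
underfitting nor among the overfitting parameters.
-/

/-! ### Cumulant generating functions of centred finite distributions -/

section Cumulant
variable {β : Type*} [Fintype β] {p y : β → ℝ} {R : ℝ}

lemma one_le_sum_mul_exp (hp : ∀ b, 0 ≤ p b) (hp1 : ∑ b, p b = 1)
    (hc : ∑ b, p b * y b = 0) : 1 ≤ ∑ b, p b * Real.exp (y b) := by
  calc (1 : ℝ) = ∑ b, p b * (y b + 1) := by simp [mul_add, Finset.sum_add_distrib, hp1, hc]
    _ ≤ _ := Finset.sum_le_sum fun b _ =>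
      mul_le_mul_of_nonneg_left (Real.add_one_le_exp _) (hp b)

lemma log_sum_mul_exp_nonneg (hp : ∀ b, 0 ≤ p b) (hp1 : ∑ b, p b = 1)
    (hc : ∑ b, p b * y b = 0) : 0 ≤ Real.log (∑ b, p b * Real.exp (y b)) :=
  Real.log_nonneg (one_le_sum_mul_exp hp hp1 hc)

lemma sum_mul_sq_le (hp : ∀ b, 0 ≤ p b) (hp1 : ∑ b, p b = 1) (hR : ∀ b, |y b| ≤ R) :
    ∑ b, p b * y b ^ 2 ≤ R ^ 2 := by
  calc ∑ b, p b * y b ^ 2 ≤ ∑ b, p b * R ^ 2 := by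
        refine Finset.sum_le_sum fun b _ => mul_le_mul_of_nonneg_left ?_ (hp b)
        rw [← sq_abs]
        exact pow_le_pow_left₀ (abs_nonneg _) (hR b) 2
    _ = R ^ 2 := by rw [← Finset.sum_mul, hp1, one_mul]

/-- No smallness of `R` is needed: for `R > 1` the trivial bound `R ≤ R ^ 2` takes over. -/
lemma log_sum_mul_exp_le (hp : ∀ b, 0 ≤ p b) (hp1 : ∑ b, p b = 1)
    (hc : ∑ b, p b * y b = 0) (hR : ∀ b, |y b| ≤ R) :
    Real.log (∑ b, p b * Real.exp (y b)) ≤ R ^ 2 := by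
  have hpos : 0 < ∑ b, p b * Real.exp (y b) :=
    one_pos.trans_le (one_le_sum_mul_exp hp hp1 hc)
  rcases le_or_gt R 1 with h1 | h1
  · have h : ∑ b, p b * Real.exp (y b) ≤ 1 + ∑ b, p b * y b ^ 2 := by
      calc ∑ b, p b * Real.exp (y b) ≤ ∑ b, p b * (1 + y b + y b ^ 2) := by
            refine Finset.sum_le_sum fun b _ => mul_le_mul_of_nonneg_left ?_ (hp b)
            have := (abs_le.1 (Real.abs_exp_sub_one_sub_id_le ((hR b).trans h1))).2
            linarith
        _ = _ := by simp [mul_add, Finset.sum_add_distrib, hp1, hc]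
    have := Real.log_le_sub_one_of_pos hpos
    have := sum_mul_sq_le hp hp1 hR
    linarith
  · have h : ∑ b, p b * Real.exp (y b) ≤ Real.exp R := by
      calc ∑ b, p b * Real.exp (y b) ≤ ∑ b, p b * Real.exp R := by
            refine Finset.sum_le_sum fun b _ => mul_le_mul_of_nonneg_left ?_ (hp b)
            exact Real.exp_le_exp.2 ((le_abs_self _).trans (hR b))
        _ = _ := by rw [← Finset.sum_mul, hp1, one_mul]
    have := Real.log_le_log hpos h
    rw [Real.log_exp] at this
    nlinarith

/-- The cumulant generating function is half the variance up to a cubic error. For `R > 1` the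
error term exceeds the variance and the bound reduces to Jensen's inequality. -/
lemma half_variance_sub_le_log_sum_mul_exp (hp : ∀ b, 0 ≤ p b) (hp1 : ∑ b, p b = 1)
    (hc : ∑ b, p b * y b = 0) (hR0 : 0 ≤ R) (hR : ∀ b, |y b| ≤ R) :
    (∑ b, p b * y b ^ 2) / 2 - R ^ 3 ≤ Real.log (∑ b, p b * Real.exp (y b)) := by
  have hs := sum_mul_sq_le hp hp1 hR
  have hlog := log_sum_mul_exp_nonneg hp hp1 hc
  rcases le_or_gt R 1 with h1 | h1
  · have h : 1 + ((∑ b, p b * y b ^ 2) / 2 - 2 / 9 * R ^ 3) ≤ ∑ b, p b * Real.exp (y b) := by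
      calc 1 + ((∑ b, p b * y b ^ 2) / 2 - 2 / 9 * R ^ 3)
          = ∑ b, p b * (1 + y b + y b ^ 2 / 2 - 2 / 9 * R ^ 3) := by
            simp only [mul_add, mul_sub, Finset.sum_add_distrib, Finset.sum_sub_distrib,
              ← Finset.sum_mul, mul_one, hp1, hc, one_mul, ← mul_div_assoc, ← Finset.sum_div]
            ring
        _ ≤ _ := by
            refine Finset.sum_le_sum fun b _ => mul_le_mul_of_nonneg_left ?_ (hp b)
            have h3 := (abs_le.1 (Real.exp_bound ((hR b).trans h1) (n := 3) (by norm_num))).1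
            have h4 : |y b| ^ 3 ≤ R ^ 3 := pow_le_pow_left₀ (abs_nonneg _) (hR b) 3
            norm_num [Finset.sum_range_succ, Nat.factorial] at h3
            linarith
    set t := (∑ b, p b * y b ^ 2) / 2 - 2 / 9 * R ^ 3 with ht
    have hR3 : 0 ≤ R ^ 3 := by positivity
    rcases le_or_gt t 0 with ht0 | ht0
    · linarith
    · have h5 : 1 - (1 + t)⁻¹ ≤ Real.log (1 + t) :=
        Real.one_sub_inv_le_log_of_pos (by linarith)
      have h6 := Real.log_le_log (by linarith) h
      have h7 : t - t ^ 2 ≤ 1 - (1 + t)⁻¹ := by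
        have : 1 - (1 + t)⁻¹ - (t - t ^ 2) = t ^ 3 / (1 + t) := by field_simp; ring
        have : 0 ≤ t ^ 3 / (1 + t) := by positivity
        linarith
      have h8 : t ≤ R ^ 2 / 2 := by linarith
      have h9 : t ^ 2 ≤ R ^ 3 / 4 := by
        calc t ^ 2 ≤ (R ^ 2 / 2) ^ 2 := pow_le_pow_left₀ ht0.le h8 2
          _ = R ^ 3 * R / 4 := by ring
          _ ≤ R ^ 3 * 1 / 4 := by gcongr
          _ = _ := by ring
      linarith
  · have : R ^ 2 ≤ R ^ 3 := pow_le_pow_right₀ h1.le (by norm_num)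
    have : 0 ≤ R ^ 2 := by positivity
    linarith

end Cumulant

lemma abs_dotProduct_le {ι : Type*} [Fintype ι] (h u : ι → ℝ) :
    |h ⬝ᵥ u| ≤ ‖h‖ * ∑ k, |u k| := by
  rw [dotProduct, Finset.mul_sum]
  refine (Finset.abs_sum_le_sum_abs _ _).trans (Finset.sum_le_sum fun k _ => ?_)
  rw [abs_mul]
  exact mul_le_mul_of_nonneg_right (norm_le_pi_norm h k) (abs_nonneg _)

/-! ### The log-likelihood as an exponential family -/

section Likelihood
variable {m : ℕ} (M : FeatureGroups m) {n : ℕ} (v : Fin n → M.NodeFeatures)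

lemma dyadProb_pos (θ : Coef m → ℝ) (e : NodePair n) (d : Bool × Bool) :
    0 < dyadProb M v θ e d := by
  unfold dyadProb
  positivity

lemma sum_dyadProb (θ : Coef m → ℝ) (e : NodePair n) : ∑ d, dyadProb M v θ e d = 1 := by
  unfold dyadProb
  rw [← Finset.sum_div]
  exact div_self (by positivity)

lemma sum_dyadProb_smul_dyadScore (θ : Coef m → ℝ) (e : NodePair n) :
    ∑ d, dyadProb M v θ e d • dyadScore M v θ e d = 0 := by
  simp only [dyadScore, smul_sub, Finset.sum_sub_distrib]
  rw [← Finset.sum_smul, sum_dyadProb, one_smul, sub_self]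

lemma sum_dyadProb_mul_dotProduct_dyadScore (θ h : Coef m → ℝ) (e : NodePair n) :
    ∑ d, dyadProb M v θ e d * (h ⬝ᵥ dyadScore M v θ e d) = 0 := by
  have := congrArg (fun u => h ⬝ᵥ u) (sum_dyadProb_smul_dyadScore M v θ e)
  simpa only [dotProduct_sum, dotProduct_smul, smul_eq_mul, dotProduct_zero] using this

/-- The score `∇ ℒ(θ)` of the whole network. -/
noncomputable def networkScore (θ : Coef m → ℝ) (x : Network n) : Coef m → ℝ :=
  ∑ e, dyadScore M v θ e (dyadOf x e)

/-- The amount by which the log-likelihood at `θ + h` falls below its linearization at `θ`: a sum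
of cumulant generating functions of the dyad scores. It does not depend on the data. -/
noncomputable def likelihoodGap (θ h : Coef m → ℝ) : ℝ :=
  ∑ e : NodePair n, Real.log (∑ d, dyadProb M v θ e d * Real.exp (h ⬝ᵥ dyadScore M v θ e d))

lemma dyadProb_add (θ h : Coef m → ℝ) (e : NodePair n) (d : Bool × Bool) :
    dyadProb M v (θ + h) e d = dyadProb M v θ e d * Real.exp (h ⬝ᵥ dyadScore M v θ e d) /
      ∑ d', dyadProb M v θ e d' * Real.exp (h ⬝ᵥ dyadScore M v θ e d') := by
  -- The centring of the score multiplies numerator and denominator by the same factor.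
  set c := ∑ d' : Bool × Bool, dyadProb M v θ e d' • dyadStat M v e d' with hc
  set Z := ∑ d' : Bool × Bool, Real.exp (θ ⬝ᵥ dyadStat M v e d') with hZ
  have hZ0 : Z ≠ 0 := by positivity
  have key : ∀ d, dyadProb M v θ e d * Real.exp (h ⬝ᵥ dyadScore M v θ e d)
      = Real.exp ((θ + h) ⬝ᵥ dyadStat M v e d) * (Real.exp (-(h ⬝ᵥ c)) / Z) := by
    intro d
    rw [dyadProb, dyadScore, dotProduct_sub, add_dotProduct, sub_eq_add_neg, Real.exp_add,
      Real.exp_add]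
    ring
  simp only [key]
  rw [← Finset.sum_mul, mul_div_mul_right _ _ (by positivity)]
  rfl

theorem logLik_add (θ h : Coef m → ℝ) (x : Network n) :
    logLik M v (θ + h) x
      = logLik M v θ x + h ⬝ᵥ networkScore M v θ x - likelihoodGap M v θ h := by
  unfold logLik networkScore likelihoodGap
  rw [dotProduct_sum, ← Finset.sum_add_distrib, ← Finset.sum_sub_distrib]
  refine Finset.sum_congr rfl fun e _ => ?_
  have hp := dyadProb_pos M v θ e
  rw [dyadProb_add, Real.log_div, Real.log_mul, Real.log_exp]
  · exact (hp _).ne'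
  · exact (Real.exp_pos _).ne'
  · exact (mul_pos (hp _) (Real.exp_pos _)).ne'
  · exact (Finset.sum_pos (fun d _ => mul_pos (hp d) (Real.exp_pos _))
      Finset.univ_nonempty).ne'

lemma likelihoodGap_nonneg (θ h : Coef m → ℝ) : 0 ≤ likelihoodGap M v θ h :=
  Finset.sum_nonneg fun e _ => log_sum_mul_exp_nonneg (fun d => (dyadProb_pos M v θ e d).le)
    (sum_dyadProb M v θ e) (sum_dyadProb_mul_dotProduct_dyadScore M v θ h e)

lemma logLik_add_le (θ h : Coef m → ℝ) (x : Network n) :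
    logLik M v (θ + h) x ≤ logLik M v θ x + h ⬝ᵥ networkScore M v θ x := by
  linarith [logLik_add M v θ h x, likelihoodGap_nonneg M v θ h]

lemma continuous_logLik (x : Network n) : Continuous fun θ => logLik M v θ x := by
  unfold logLik
  refine continuous_finsetSum _ fun e _ => Continuous.log ?_ fun θ => (dyadProb_pos M v θ e _).ne'
  unfold dyadProb dotProduct
  refine Continuous.div (by fun_prop) (by fun_prop) fun θ => ?_
  positivity

/-- A bound for the `ℓ¹` norm of the statistics of a dyad, uniform over its four values. -/
noncomputable def dyadBound (e : NodePair n) : ℝ :=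
  3 + 2 * ∑ k, (|M.w k (v e.1.1 k) (v e.1.2 k)| + |M.g k (v e.1.1 k)| + |M.g k (v e.1.2 k)|)

lemma one_le_dyadBound (e : NodePair n) : 1 ≤ dyadBound M v e := by
  have : 0 ≤ ∑ k, (|M.w k (v e.1.1 k) (v e.1.2 k)| + |M.g k (v e.1.1 k)|
    + |M.g k (v e.1.2 k)|) := by positivity
  unfold dyadBound
  linarith

lemma abs_bit_le (b : Bool) : |bit b| ≤ 1 := by cases b <;> simp [bit]

lemma sum_abs_dyadStat_le (e : NodePair n) (d : Bool × Bool) :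
    ∑ k, |dyadStat M v e d k| ≤ dyadBound M v e := by
  have h1 := abs_bit_le d.1
  have h2 := abs_bit_le d.2
  have hmul : ∀ (b : Bool) (a : ℝ), |bit b * a| ≤ |a| := fun b a => by
    rw [abs_mul]
    exact mul_le_of_le_one_left (abs_nonneg _) (abs_bit_le b)
  have hadd : |bit d.1 + bit d.2| ≤ 2 := (abs_add_le _ _).trans (by linarith)
  have e1 : |bit d.1 * bit d.2| ≤ 1 := (hmul _ _).trans h2
  have e2 : ∀ a b : ℝ, |bit d.1 * a + bit d.2 * b| ≤ |a| + |b| := fun a b =>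
    (abs_add_le _ _).trans (add_le_add (hmul _ _) (hmul _ _))
  have e3 : ∀ a : ℝ, |(bit d.1 + bit d.2) * a| ≤ 2 * |a| := fun a => by
    rw [abs_mul]
    exact mul_le_mul_of_nonneg_right hadd (abs_nonneg _)
  simp only [Fintype.sum_sum_type, dyadStat, coefVec, Sum.elim_inl, Sum.elim_inr,
    Fin.sum_univ_two, Matrix.cons_val_zero, Matrix.cons_val_one]
  have s1 := Finset.sum_le_sum fun k (_ : k ∈ Finset.univ) => e3 (M.w k (v e.1.1 k) (v e.1.2 k))
  have s2 := Finset.sum_le_sum fun k (_ : k ∈ Finset.univ) =>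
    e2 (M.g k (v e.1.1 k)) (M.g k (v e.1.2 k))
  have s3 := Finset.sum_le_sum fun k (_ : k ∈ Finset.univ) =>
    e2 (M.g k (v e.1.2 k)) (M.g k (v e.1.1 k))
  simp only [Finset.sum_add_distrib, ← Finset.mul_sum] at s1 s2 s3
  simp only [dyadBound, Finset.sum_add_distrib]
  linarith

lemma sum_abs_dyadScore_le (θ : Coef m → ℝ) (e : NodePair n) (d : Bool × Bool) :
    ∑ k, |dyadScore M v θ e d k| ≤ 2 * dyadBound M v e := by
  have hmean : ∑ k, |(∑ d', dyadProb M v θ e d' • dyadStat M v e d') k| ≤ dyadBound M v e := by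
    calc ∑ k, |(∑ d', dyadProb M v θ e d' • dyadStat M v e d') k|
        ≤ ∑ k, ∑ d', dyadProb M v θ e d' * |dyadStat M v e d' k| := by
          refine Finset.sum_le_sum fun k _ => ?_
          rw [Finset.sum_apply]
          refine (Finset.abs_sum_le_sum_abs _ _).trans (Finset.sum_le_sum fun d' _ => ?_)
          rw [Pi.smul_apply, smul_eq_mul, abs_mul, abs_of_pos (dyadProb_pos M v θ e d')]
      _ = ∑ d', dyadProb M v θ e d' * ∑ k, |dyadStat M v e d' k| := by
          rw [Finset.sum_comm]
          simp only [Finset.mul_sum]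
      _ ≤ ∑ d', dyadProb M v θ e d' * dyadBound M v e := by
          gcongr with d'
          · exact (dyadProb_pos M v θ e d').le
          · exact sum_abs_dyadStat_le M v e d'
      _ = dyadBound M v e := by rw [← Finset.sum_mul, sum_dyadProb, one_mul]
  calc ∑ k, |dyadScore M v θ e d k|
      ≤ ∑ k, (|dyadStat M v e d k| + |(∑ d', dyadProb M v θ e d' • dyadStat M v e d') k|) :=
        Finset.sum_le_sum fun k _ => abs_sub _ _
    _ ≤ _ := by
        rw [Finset.sum_add_distrib]
        linarith [sum_abs_dyadStat_le M v e d]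

lemma abs_dotProduct_dyadScore_le (θ h : Coef m → ℝ) (e : NodePair n) (d : Bool × Bool) :
    |h ⬝ᵥ dyadScore M v θ e d| ≤ ‖h‖ * (2 * dyadBound M v e) :=
  (abs_dotProduct_le _ _).trans
    (mul_le_mul_of_nonneg_left (sum_abs_dyadScore_le M v θ e d) (norm_nonneg h))

lemma likelihoodGap_le (θ h : Coef m → ℝ) :
    likelihoodGap M v θ h ≤ 4 * ‖h‖ ^ 2 * ∑ e, dyadBound M v e ^ 3 := by
  rw [Finset.mul_sum]
  refine Finset.sum_le_sum fun e _ => ?_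
  refine (log_sum_mul_exp_le (fun d => (dyadProb_pos M v θ e d).le)
    (sum_dyadProb M v θ e) (sum_dyadProb_mul_dotProduct_dyadScore M v θ h e)
    (abs_dotProduct_dyadScore_le M v θ h e)).trans ?_
  calc (‖h‖ * (2 * dyadBound M v e)) ^ 2 = 4 * ‖h‖ ^ 2 * dyadBound M v e ^ 2 := by ring
    _ ≤ _ := by
      gcongr
      · exact one_le_dyadBound M v e
      · norm_num

lemma dotProduct_fisherInfo_mulVec (θ u : Coef m → ℝ) :
    u ⬝ᵥ (fisherInfo M v θ).mulVec u = (numDyads n)⁻¹ * ∑ e : NodePair n, ∑ d,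
      dyadProb M v θ e d * (u ⬝ᵥ dyadScore M v θ e d) ^ 2 := by
  simp only [fisherInfo, Matrix.smul_mulVec, dotProduct_smul, smul_eq_mul, Matrix.sum_mulVec,
    dotProduct_sum, Matrix.vecMulVec_mulVec]
  congr 1
  refine Finset.sum_congr rfl fun e _ => Finset.sum_congr rfl fun d _ => ?_
  rw [dotProduct_comm (dyadScore M v θ e d) u]
  simp only [MulOpposite.smul_eq_mul_unop, MulOpposite.unop_op]
  ring

lemma le_likelihoodGap (hN : 0 < numDyads n) (θ h : Coef m → ℝ) :
    numDyads n * (h ⬝ᵥ (fisherInfo M v θ).mulVec h) / 2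
      - 8 * ‖h‖ ^ 3 * ∑ e, dyadBound M v e ^ 3 ≤ likelihoodGap M v θ h := by
  rw [dotProduct_fisherInfo_mulVec, mul_inv_cancel_left₀ hN.ne', Finset.sum_div, Finset.mul_sum,
    ← Finset.sum_sub_distrib]
  refine Finset.sum_le_sum fun e _ => ?_
  have := half_variance_sub_le_log_sum_mul_exp (fun d => (dyadProb_pos M v θ e d).le)
    (sum_dyadProb M v θ e) (sum_dyadProb_mul_dotProduct_dyadScore M v θ h e)
    (mul_nonneg (norm_nonneg h) (by linarith [one_le_dyadBound M v e]))
    (abs_dotProduct_dyadScore_le M v θ h e)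
  refine le_trans (le_of_eq ?_) this
  ring

lemma card_nodePair (n : ℕ) : (Fintype.card (NodePair n) : ℝ) = numDyads n := by
  have h := sum_ne_eq (n := n) fun _ _ => 1
  have h2 : ∀ a : Fin n, (∑ b, if a ≠ b then (1 : ℝ) else 0) = n - 1 := by
    intro a
    have : ∀ b, (if a ≠ b then (1 : ℝ) else 0) = 1 - if a = b then 1 else 0 := by
      intro b; split_ifs <;> simp_all
    simp only [this, Finset.sum_sub_distrib]
    simp
  simp only [h2] at h
  simp only [Finset.sum_const, Finset.card_univ, Fintype.card_fin, nsmul_eq_mul] at h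
  unfold numDyads
  linarith

/-- The cubes of the dyad bounds sum to `O(N)` under the third moment condition. -/
lemma sum_dyadBound_pow_le {C : ℝ} (hC : thirdMoment M v ≤ C * numDyads n) :
    ∑ e, dyadBound M v e ^ 3 ≤ (108 + 288 * (m : ℝ) ^ 2 * C) * numDyads n := by
  have hcube : ∀ a b c : ℝ, 0 ≤ a → 0 ≤ b → 0 ≤ c →
      (a + b + c) ^ 3 ≤ 9 * (a ^ 3 + b ^ 3 + c ^ 3) := by
    intro a b c ha hb hc
    nlinarith [mul_nonneg (add_nonneg ha hb) (sq_nonneg (a - b)),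
      mul_nonneg (add_nonneg hb hc) (sq_nonneg (b - c)),
      mul_nonneg (add_nonneg ha hc) (sq_nonneg (a - c)),
      mul_nonneg ha (sq_nonneg (b - c)), mul_nonneg hb (sq_nonneg (a - c)),
      mul_nonneg hc (sq_nonneg (a - b))]
  have hpm : ∀ a b : ℝ, 0 ≤ a → 0 ≤ b → (a + b) ^ 3 ≤ 4 * (a ^ 3 + b ^ 3) := by
    intro a b ha hb
    nlinarith [mul_nonneg (add_nonneg ha hb) (sq_nonneg (a - b))]
  have key : ∀ e : NodePair n, dyadBound M v e ^ 3 ≤ 108 + 288 * (m : ℝ) ^ 2 * ∑ k : Fin m,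
      (|M.w k (v e.1.1 k) (v e.1.2 k)| ^ 3 + |M.g k (v e.1.1 k)| ^ 3
        + |M.g k (v e.1.2 k)| ^ 3) := by
    intro e
    set s := fun k => |M.w k (v e.1.1 k) (v e.1.2 k)| + |M.g k (v e.1.1 k)|
      + |M.g k (v e.1.2 k)| with hs
    have hs0 : ∀ k, 0 ≤ s k := fun k => by positivity
    have h1 : (∑ k, s k) ^ 3 ≤ (m : ℝ) ^ 2 * ∑ k, s k ^ 3 := by
      simpa using pow_sum_le_card_mul_sum_pow (s := Finset.univ) (fun k _ => hs0 k) 2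
    have h2 : ∑ k, s k ^ 3 ≤ 9 * ∑ k : Fin m,
      (|M.w k (v e.1.1 k) (v e.1.2 k)| ^ 3 + |M.g k (v e.1.1 k)| ^ 3
        + |M.g k (v e.1.2 k)| ^ 3) := by
      rw [Finset.mul_sum]
      exact Finset.sum_le_sum fun k _ =>
        hcube _ _ _ (abs_nonneg _) (abs_nonneg _) (abs_nonneg _)
    have h3 := hpm 3 (2 * ∑ k, s k) (by norm_num)
      (mul_nonneg zero_le_two (Finset.sum_nonneg fun k _ => hs0 k))
    have h4 := h1.trans (mul_le_mul_of_nonneg_left h2 (sq_nonneg (m : ℝ)))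
    have h5 : dyadBound M v e = 3 + 2 * ∑ k, s k := rfl
    rw [h5]
    nlinarith
  calc ∑ e, dyadBound M v e ^ 3 ≤ _ := Finset.sum_le_sum fun e _ => key e
    _ = 108 * numDyads n + 288 * (m : ℝ) ^ 2 * thirdMoment M v := by
      rw [Finset.sum_add_distrib, ← Finset.mul_sum, thirdMoment, ← card_nodePair]
      simp [mul_comm]
    _ ≤ _ := by
      have := mul_le_mul_of_nonneg_left hC (by positivity : 0 ≤ 288 * (m : ℝ) ^ 2)
      linarith

end Likelihood

/-! ### Second moment of the score -/

/-- Additivity of the variance of a sum of independent centred variables, for a product of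
finite distributions. -/
lemma sum_prod_mul_sq_sum {ι β : Type*} [Fintype ι] [DecidableEq ι] [Fintype β]
    (p f : ι → β → ℝ) (hp1 : ∀ i, ∑ b, p i b = 1) (hc : ∀ i, ∑ b, p i b * f i b = 0) :
    ∑ d : ι → β, (∏ i, p i (d i)) * (∑ i, f i (d i)) ^ 2 = ∑ i, ∑ b, p i b * f i b ^ 2 := by
  have key : ∀ i j : ι, ∑ d : ι → β, (∏ e, p e (d e)) * (f i (d i) * f j (d j))
      = if i = j then ∑ b, p i b * f i b ^ 2 else 0 := by
    intro i j
    have h1 : ∀ d : ι → β, (∏ e, p e (d e)) * (f i (d i) * f j (d j))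
        = ∏ e, p e (d e) * ((if e = i then f e (d e) else 1) *
            (if e = j then f e (d e) else 1)) := by
      intro d
      rw [Finset.prod_mul_distrib, Finset.prod_mul_distrib]
      simp
    simp only [h1]
    rw [← Fintype.piFinset_univ, ← Finset.prod_univ_sum (fun _ => Finset.univ)
      (fun e b => p e b * ((if e = i then f e b else 1) * (if e = j then f e b else 1)))]
    split_ifs with hij
    · subst hij
      rw [Finset.prod_eq_single i]
      · simp [sq]
      · intro e _ he
        simp [he, hp1]
      · simp
    · exact Finset.prod_eq_zero (Finset.mem_univ i) (by simp [hij, hc])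
  calc ∑ d : ι → β, (∏ i, p i (d i)) * (∑ i, f i (d i)) ^ 2
      = ∑ d : ι → β, ∑ i, ∑ j, (∏ e, p e (d e)) * (f i (d i) * f j (d j)) := by
        refine Finset.sum_congr rfl fun d _ => ?_
        rw [sq, Finset.sum_mul_sum, Finset.mul_sum]
        simp only [Finset.mul_sum]
    _ = ∑ i, ∑ j, ∑ d : ι → β, (∏ e, p e (d e)) * (f i (d i) * f j (d j)) := by
        rw [Finset.sum_comm]
        exact Finset.sum_congr rfl fun i _ => Finset.sum_comm
    _ = _ := by simp [key]

section Score
variable {m : ℕ} (M : FeatureGroups m) {n : ℕ} (v : Fin n → M.NodeFeatures)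

lemma networkProb_nonneg (θ : Coef m → ℝ) (x : Network n) : 0 ≤ networkProb M v θ x := by
  rw [networkProb_eq_prod]
  exact Finset.prod_nonneg fun e _ => (dyadProb_pos M v θ e _).le

lemma sum_networkProb (θ : Coef m → ℝ) : ∑ x, networkProb M v θ x = 1 := by
  unfold networkProb
  rw [← Finset.sum_div]
  have : Nonempty (Network n) := ⟨⟨fun _ _ => false, fun _ => rfl⟩⟩
  exact div_self (Finset.sum_pos (fun _ _ => Real.exp_pos _) Finset.univ_nonempty).ne'

lemma eventProb_mono (θ : Coef m → ℝ) {E F : Set (Network n)} (h : E ⊆ F) :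
    eventProb M v θ E ≤ eventProb M v θ F := by
  classical
  unfold eventProb
  refine Finset.sum_le_sum fun x _ => ?_
  split_ifs with h1 h2
  · exact le_rfl
  · exact absurd (h h1) h2
  · exact networkProb_nonneg M v θ x
  · exact le_rfl

lemma eventProb_le_one (θ : Coef m → ℝ) (E : Set (Network n)) : eventProb M v θ E ≤ 1 := by
  classical
  rw [← sum_networkProb M v θ]
  refine Finset.sum_le_sum fun x _ => ?_
  split_ifs
  · exact le_rfl
  · exact networkProb_nonneg M v θ x

/-- Markov's inequality. -/
lemma one_sub_le_eventProb (θ : Coef m → ℝ) (f : Network n → ℝ) (hf : ∀ x, 0 ≤ f x) {a : ℝ}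
    (ha : 0 < a) :
    1 - (∑ x, networkProb M v θ x * f x) / a ≤ eventProb M v θ {x | f x ≤ a} := by
  classical
  unfold eventProb
  rw [← sum_networkProb M v θ, Finset.sum_div, ← Finset.sum_sub_distrib]
  refine Finset.sum_le_sum fun x _ => ?_
  have hp := networkProb_nonneg M v θ x
  split_ifs with h
  · have : 0 ≤ networkProb M v θ x * f x / a := div_nonneg (mul_nonneg hp (hf x)) ha.le
    linarith
  · have h' : a ≤ f x := (not_le.1 h).le
    rw [sub_nonpos, le_div_iff₀ ha]
    exact mul_le_mul_of_nonneg_left h' hp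

lemma sum_networkProb_mul_networkScore_sq (θ : Coef m → ℝ) (k : Coef m) :
    ∑ x, networkProb M v θ x * networkScore M v θ x k ^ 2
      = ∑ e : NodePair n, ∑ d, dyadProb M v θ e d * dyadScore M v θ e d k ^ 2 := by
  rw [← sum_prod_mul_sq_sum (fun e d => dyadProb M v θ e d) (fun e d => dyadScore M v θ e d k)
    (sum_dyadProb M v θ), ← Function.Bijective.sum_comp (dyadOf_bijective (n := n))]
  · refine Finset.sum_congr rfl fun x _ => ?_
    rw [networkProb_eq_prod, networkScore, Finset.sum_apply]
  · intro e
    simpa using congrFun (sum_dyadProb_smul_dyadScore M v θ e) k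

lemma sum_networkProb_mul_networkScore_sq_le (θ : Coef m → ℝ) (k : Coef m) :
    ∑ x, networkProb M v θ x * networkScore M v θ x k ^ 2 ≤ 4 * ∑ e, dyadBound M v e ^ 3 := by
  rw [sum_networkProb_mul_networkScore_sq, Finset.mul_sum]
  refine Finset.sum_le_sum fun e _ => ?_
  refine (sum_mul_sq_le (fun d => (dyadProb_pos M v θ e d).le) (sum_dyadProb M v θ e)
    (R := 2 * dyadBound M v e) fun d => ?_).trans ?_
  · exact (Finset.single_le_sum (f := fun k => |dyadScore M v θ e d k|)
      (fun _ _ => abs_nonneg _) (Finset.mem_univ k)).trans (sum_abs_dyadScore_le M v θ e d)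
  · have : dyadBound M v e ^ 2 ≤ dyadBound M v e ^ 3 :=
      pow_le_pow_right₀ (one_le_dyadBound M v e) (by norm_num)
    linarith [mul_pow 2 (dyadBound M v e) 2]

/-- The score is of order `√N` in probability. -/
lemma one_sub_le_eventProb_networkScore (θ : Coef m → ℝ) {C K : ℝ} (hK : 0 < K)
    (hN : 0 < numDyads n) (hC : ∑ e, dyadBound M v e ^ 3 ≤ C * numDyads n) :
    1 - 4 * C * Fintype.card (Coef m) / K ^ 2 ≤
      eventProb M v θ {x | ∀ k, |networkScore M v θ x k| ≤ K * Real.sqrt (numDyads n)} := by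
  have h1 := one_sub_le_eventProb M v θ (fun x => ∑ k, networkScore M v θ x k ^ 2)
    (fun x => Finset.sum_nonneg fun k _ => sq_nonneg _) (a := K ^ 2 * numDyads n) (by positivity)
  have h2 : ∑ x, networkProb M v θ x * ∑ k, networkScore M v θ x k ^ 2
      ≤ Fintype.card (Coef m) * (4 * (C * numDyads n)) := by
    simp only [Finset.mul_sum]
    rw [Finset.sum_comm, ← nsmul_eq_mul, ← Finset.card_univ]
    refine Finset.sum_le_card_nsmul _ _ _ fun k _ => ?_
    exact (sum_networkProb_mul_networkScore_sq_le M v θ k).trans (by linarith)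
  refine le_trans ?_ (h1.trans (eventProb_mono M v θ ?_))
  · have h3 := div_le_div_of_nonneg_right h2 (by positivity : 0 ≤ K ^ 2 * numDyads n)
    have h4 : Fintype.card (Coef m) * (4 * (C * numDyads n)) / (K ^ 2 * numDyads n)
        = 4 * C * Fintype.card (Coef m) / K ^ 2 := by field_simp
    linarith
  · intro x hx k
    have h5 : networkScore M v θ x k ^ 2 ≤ (K * Real.sqrt (numDyads n)) ^ 2 := by
      rw [mul_pow, Real.sq_sqrt hN.le]
      exact (Finset.single_le_sum (f := fun k => networkScore M v θ x k ^ 2)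
        (fun _ _ => sq_nonneg _) (Finset.mem_univ k)).trans hx
    exact abs_le_of_sq_le_sq h5 (by positivity)

end Score

/-! ### Concave criteria pinched between two quadratics -/

/-- `f` is a concave function which, seen from `θ₀` at scale `1 / q`, lies between two
quadratic polynomials in the distance `‖θ - θ₀‖`: above the lower one everywhere, below the upper
one on the ball of radius `δ`. Concavity is
encoded by the existence of a supergradient at every point. The norm is the sup norm. -/
structure IsPinchedConcave {ι : Type*} [Fintype ι] (f : (ι → ℝ) → ℝ) (θ₀ : ι → ℝ)
    (K q a b δ : ℝ) : Prop where
  continuous : Continuous f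
  supergradient : ∀ θ, ∃ U : ι → ℝ, ∀ h, f (θ + h) ≤ f θ + h ⬝ᵥ U
  upper : ∀ θ, ‖θ - θ₀‖ ≤ δ → f θ ≤ f θ₀ + K * q * ‖θ - θ₀‖ - a * q ^ 2 * ‖θ - θ₀‖ ^ 2
  lower : ∀ θ, f θ₀ - K * q * ‖θ - θ₀‖ - b * q ^ 2 * ‖θ - θ₀‖ ^ 2 ≤ f θ

namespace IsPinchedConcave
variable {ι : Type*} [Fintype ι] {f : (ι → ℝ) → ℝ} {Θ : Set (ι → ℝ)} {θ₀ : ι → ℝ}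
  {K q a b δ : ℝ}

/-- Concavity carries the quadratic upper bound on the sphere of radius `δ` outwards along rays,
as a linear bound. -/
lemma le_of_le_norm (hf : IsPinchedConcave f θ₀ K q a b δ) (hδ : 0 < δ) {θ : ι → ℝ}
    (hθ : δ ≤ ‖θ - θ₀‖) : f θ ≤ f θ₀ + ‖θ - θ₀‖ * (K * q - a * q ^ 2 * δ) := by
  set h := θ - θ₀ with hh
  have hpos : 0 < ‖h‖ := hδ.trans_le hθ
  set t := δ / ‖h‖ with ht
  have ht0 : 0 < t := div_pos hδ hpos
  have ht1 : t ≤ 1 := (div_le_one hpos).2 hθ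
  have htn : t * ‖h‖ = δ := div_mul_cancel₀ _ hpos.ne'
  obtain ⟨U, hU⟩ := hf.supergradient (θ₀ + t • h)
  have h1 := hU (-(t • h))
  have h2 := hU ((1 - t) • h)
  rw [add_neg_cancel_right, neg_dotProduct, smul_dotProduct, smul_eq_mul] at h1
  have e2 : θ₀ + t • h + (1 - t) • h = θ := by
    rw [add_assoc, ← add_smul, add_sub_cancel, one_smul, hh, add_sub_cancel]
  rw [e2, smul_dotProduct, smul_eq_mul] at h2
  have e3 : ‖θ₀ + t • h - θ₀‖ = δ := by
    rw [add_sub_cancel_left, norm_smul, Real.norm_of_nonneg ht0.le, htn]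
  have h3 := hf.upper (θ₀ + t • h) e3.le
  rw [e3] at h3
  have h4 : t * (f θ - f θ₀) ≤ t * (‖h‖ * (K * q - a * q ^ 2 * δ)) := by
    have h5 := mul_le_mul_of_nonneg_left h1 (sub_nonneg.2 ht1)
    have h6 := mul_le_mul_of_nonneg_left h2 ht0.le
    rw [← mul_assoc t, htn]
    nlinarith
  linarith [le_of_mul_le_mul_left h4 ht0]

lemma le_add_sq_div (hf : IsPinchedConcave f θ₀ K q a b δ) (hδ : 0 < δ) (ha : 0 < a)
    (hq : K * q ≤ a * q ^ 2 * δ) (θ : ι → ℝ) : f θ ≤ f θ₀ + K ^ 2 / a := by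
  have h0 : 0 ≤ K ^ 2 / a := by positivity
  rcases le_total ‖θ - θ₀‖ δ with h | h
  · have h1 := hf.upper θ h
    have h2 : K * q * ‖θ - θ₀‖ - a * q ^ 2 * ‖θ - θ₀‖ ^ 2 ≤ K ^ 2 / a := by
      rw [le_div_iff₀ ha]
      nlinarith [sq_nonneg (K - 2 * (a * q * ‖θ - θ₀‖)), sq_nonneg K]
    linarith
  · have h1 := hf.le_of_le_norm hδ h
    have := mul_nonneg (norm_nonneg (θ - θ₀)) (sub_nonneg.2 hq)
    linarith

/-- A point at which `f` has lost little against `θ₀`, relative to its distance from `θ₀`, is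
within `O(1 / q)` of `θ₀`. -/
lemma norm_sub_le (hf : IsPinchedConcave f θ₀ K q a b δ) (hδ : 0 < δ) (ha : 0 < a) (hq : 0 < q)
    {s : ℝ} (hs : K + s < a * q * δ) (hs0 : 0 ≤ K + s) {θ : ι → ℝ}
    (hθ : f θ₀ - s * q * ‖θ - θ₀‖ ≤ f θ) : ‖θ - θ₀‖ ≤ (K + s) / (a * q) := by
  rcases (norm_nonneg (θ - θ₀)).eq_or_lt with h0 | h0
  · rw [← h0]
    positivity
  rcases le_or_gt ‖θ - θ₀‖ δ with h | h
  · have h1 := hf.upper θ h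
    rw [le_div_iff₀ (by positivity)]
    have h2 : q * ‖θ - θ₀‖ * (‖θ - θ₀‖ * (a * q)) ≤ q * ‖θ - θ₀‖ * (K + s) := by nlinarith
    exact le_of_mul_le_mul_left h2 (by positivity)
  · have h1 := hf.le_of_le_norm hδ h.le
    have h2 := mul_pos (mul_pos hq h0) (sub_pos.2 hs)
    nlinarith

lemma exists_isMaxOn (hf : IsPinchedConcave f θ₀ K q a b δ) (hδ : 0 < δ)
    (hq : K * q ≤ a * q ^ 2 * δ) (hΘ : Metric.closedBall θ₀ δ ⊆ Θ) :
    ∃ θ ∈ Θ, IsMaxOn f Θ θ := by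
  obtain ⟨θ, hθ, hmax⟩ := (isCompact_closedBall θ₀ δ).exists_isMaxOn
    ⟨θ₀, Metric.mem_closedBall_self hδ.le⟩ hf.continuous.continuousOn
  refine ⟨θ, hΘ hθ, fun t _ => ?_⟩
  rcases le_total ‖t - θ₀‖ δ with h | h
  · exact hmax (mem_closedBall_iff_norm.2 h)
  · have h1 := hf.le_of_le_norm hδ h
    have h2 := mul_nonneg (norm_nonneg (t - θ₀)) (sub_nonneg.2 hq)
    have h3 : f θ₀ ≤ f θ := hmax (Metric.mem_closedBall_self hδ.le)
    show f t ≤ f θ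
    linarith

/-- Within `O(1 / q)` of `θ₀`, changing one coordinate changes `f` at rate at most `O(q)`: by
concavity the slope is at most the slope of a chord of length `1 / q` on the other side. -/
lemma le_update_add [DecidableEq ι] (hf : IsPinchedConcave f θ₀ K q a b δ) (hK : 0 ≤ K)
    (hb : 0 ≤ b) (ha : 0 ≤ a) (hq : 0 < q) {r : ℝ} (hrδ : r / q ≤ δ) {θ : ι → ℝ}
    (k : ι) (c : ℝ) (hθ : ‖Function.update θ k c - θ₀‖ ≤ r / q) :
    f θ ≤ f (Function.update θ k c)
      + |θ k - c| * q * (2 * K * (r + 1) + b * (r + 1) ^ 2) := by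
  set θ' := Function.update θ k c with hθ'
  set M := 2 * K * (r + 1) + b * (r + 1) ^ 2 with hM
  obtain ⟨U, hU⟩ := hf.supergradient θ'
  have e1 : θ' + Pi.single k (θ k - c) = θ := by
    funext j
    by_cases hj : j = k
    · subst hj; simp [hθ']
    · simp [hθ', hj]
  have h1 := hU (Pi.single k (θ k - c))
  rw [e1, single_dotProduct] at h1
  have hslope : |U k| ≤ q * M := by
    -- the chord points against the sign of the slope
    set σ : ℝ := ((SignType.sign (U k) : SignType) : ℝ) with hσ
    have hσU : σ * U k = |U k| := sign_mul_self (U k)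
    have hσ1 : |σ| ≤ 1 := by
      rcases lt_trichotomy (U k) 0 with h | h | h <;> simp [hσ, h]
    have h2 := hU (Pi.single k (-(σ / q)))
    rw [single_dotProduct] at h2
    set h := θ' + Pi.single k (-(σ / q)) with hh
    have hn : ‖h - θ₀‖ ≤ (r + 1) / q := by
      have e : h - θ₀ = (θ' - θ₀) + Pi.single k (-(σ / q)) := by rw [hh]; abel
      rw [e, add_div]
      refine (norm_add_le _ _).trans (add_le_add hθ ?_)
      rw [Pi.norm_single, norm_neg, norm_div, Real.norm_of_nonneg hq.le]
      exact div_le_div_of_nonneg_right hσ1 hq.le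
    have h3 := hf.lower h
    have h4 := hf.upper θ' (hθ.trans hrδ)
    have hqn : q * ‖h - θ₀‖ ≤ r + 1 := by
      rw [le_div_iff₀ hq] at hn; linarith
    have hqn' : q * ‖θ' - θ₀‖ ≤ r + 1 := by
      rw [le_div_iff₀ hq] at hθ; linarith
    have h5 : q ^ 2 * ‖h - θ₀‖ ^ 2 ≤ (r + 1) ^ 2 := by
      rw [← mul_pow]
      exact pow_le_pow_left₀ (by positivity) hqn 2
    have h6 : 0 ≤ a * q ^ 2 * ‖θ' - θ₀‖ ^ 2 := by positivity
    have h7 := mul_le_mul_of_nonneg_left hqn hK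
    have h8 := mul_le_mul_of_nonneg_left hqn' hK
    have h9 := mul_le_mul_of_nonneg_left h5 hb
    have h10 : |U k| / q ≤ M := by
      have : -(σ / q) * U k = -(|U k| / q) := by rw [← hσU]; ring
      rw [this] at h2
      nlinarith
    rw [div_le_iff₀ hq] at h10
    linarith
  have h11 : (θ k - c) * U k ≤ |θ k - c| * (q * M) :=
    (le_abs_self _).trans (by
      rw [abs_mul]
      exact mul_le_mul_of_nonneg_left hslope (abs_nonneg _))
  linarith

end IsPinchedConcave

/-! ### The adaptive penalty and sparsity of the penalized estimator -/

section Penalty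
variable {m : ℕ} (M : FeatureGroups m) {n : ℕ} (v : Fin n → M.NodeFeatures)

/-- In real numbers `|θ k| / 0 = 0`, which agrees with `∞ * 0 = 0` on the coefficient vectors of
finite penalty. -/
lemma adaptivePenalty_eq_ofReal {mle θ : Coef m → ℝ} (h : ∀ k, mle k = 0 → θ k = 0) :
    adaptivePenalty mle θ = ENNReal.ofReal (∑ k, |θ k| / |mle k|) := by
  rw [adaptivePenalty, ENNReal.ofReal_sum_of_nonneg fun k _ => by positivity]
  refine Finset.sum_congr rfl fun k _ => ?_
  by_cases hk : mle k = 0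
  · simp [hk, h k hk]
  · rw [ENNReal.ofReal_div_of_pos (abs_pos.2 hk), mul_comm, ENNReal.div_eq_inv_mul, mul_comm]

lemma adaptivePenalty_eq_top {mle θ : Coef m → ℝ} {k : Coef m} (h : mle k = 0) (h' : θ k ≠ 0) :
    adaptivePenalty mle θ = ⊤ := by
  rw [adaptivePenalty, ENNReal.sum_eq_top]
  refine ⟨k, Finset.mem_univ k, ?_⟩
  rw [h, abs_zero, ENNReal.ofReal_zero, ENNReal.inv_zero]
  exact ENNReal.top_mul (by simpa using h')

lemma penalizedCriterion_eq_coe {mle θ : Coef m → ℝ} (lam : ℝ) (x : Network n)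
    (h : ∀ k, mle k = 0 → θ k = 0) : penalizedCriterion M v mle lam x θ
      = ((-logLik M v θ x + lam * ∑ k, |θ k| / |mle k| : ℝ) : EReal) := by
  rw [penalizedCriterion, adaptivePenalty_eq_ofReal h, EReal.coe_ennreal_ofReal,
    max_eq_left (Finset.sum_nonneg fun k _ => by positivity), EReal.coe_add, EReal.coe_mul]

lemma penalizedCriterion_eq_top {mle θ : Coef m → ℝ} {lam : ℝ} (hlam : 0 < lam) (x : Network n)
    {k : Coef m} (h : mle k = 0) (h' : θ k ≠ 0) : penalizedCriterion M v mle lam x θ = ⊤ := by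
  rw [penalizedCriterion, adaptivePenalty_eq_top h h', EReal.coe_ennreal_top,
    EReal.coe_mul_top_of_pos hlam, EReal.coe_add_top]

lemma exists_isMinOn_penalizedCriterion {Θ : Set (Coef m → ℝ)} {θ₀ mle : Coef m → ℝ}
    {lam δ : ℝ} (x : Network n) (hδ : 0 < δ) (hΘ : Metric.closedBall θ₀ δ ⊆ Θ) (hlam : 0 < lam)
    (hmle : ∀ k, mle k = 0 → θ₀ k = 0)
    (hfar : ∀ θ, δ ≤ ‖θ - θ₀‖ →
      logLik M v θ x ≤ logLik M v θ₀ x - lam * ∑ k, |θ₀ k| / |mle k|) :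
    ∃ θ ∈ Θ, IsMinOn (penalizedCriterion M v mle lam x) Θ θ := by
  set F : Set (Coef m → ℝ) := {θ | ∀ k, mle k = 0 → θ k = 0} with hF
  have hFc : IsClosed F := by
    simp only [hF, Set.ofPred_forall]
    exact isClosed_iInter fun k => isClosed_iInter fun _ =>
      isClosed_eq (continuous_apply k) continuous_const
  have h0 : θ₀ ∈ Metric.closedBall θ₀ δ ∩ F := ⟨Metric.mem_closedBall_self hδ.le, hmle⟩
  have hcont : Continuous fun θ : Coef m → ℝ =>
      -logLik M v θ x + lam * ∑ k, |θ k| / |mle k| :=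
    (continuous_logLik M v x).neg.add (by fun_prop)
  obtain ⟨θ, hθ, hmin⟩ := ((isCompact_closedBall θ₀ δ).inter_right hFc).exists_isMinOn ⟨θ₀, h0⟩
    hcont.continuousOn
  refine ⟨θ, hΘ hθ.1, fun t _ => ?_⟩
  show penalizedCriterion M v mle lam x θ ≤ penalizedCriterion M v mle lam x t
  by_cases ht : t ∈ F
  · rw [penalizedCriterion_eq_coe M v lam x hθ.2, penalizedCriterion_eq_coe M v lam x ht,
      EReal.coe_le_coe_iff]
    rcases le_total ‖t - θ₀‖ δ with h | h
    · exact hmin ⟨mem_closedBall_iff_norm.2 h, ht⟩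
    · refine le_trans (hmin h0) ?_
      have h1 := hfar t h
      have h2 : 0 ≤ lam * ∑ k, |t k| / |mle k| := by positivity
      show -logLik M v θ₀ x + lam * ∑ k, |θ₀ k| / |mle k| ≤ _
      linarith
  · simp only [hF, Set.mem_ofPred_eq, not_forall] at ht
    obtain ⟨k, hk, hk'⟩ := ht
    rw [penalizedCriterion_eq_top M v hlam x hk hk']
    exact le_top

/-- Deterministic oracle property. If the likelihood is pinched at scale `1 / q`, and the tuning
parameter exceeds a constant but is small compared with `q`, then the penalized estimator has
exactly the true active set and loses only a constant in likelihood against `θ₀`. -/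
theorem activeSet_eq_and_le_logLik {Θ : Set (Coef m → ℝ)} {θ₀ mle est : Coef m → ℝ}
    {lam K q a b δ r : ℝ} {x : Network n}
    (hf : IsPinchedConcave (fun θ => logLik M v θ x) θ₀ K q a b δ)
    (hK : 0 < K) (ha : 0 < a) (hb : 0 ≤ b) (hδ : 0 < δ) (hq : 0 < q)
    (hΘ : Metric.closedBall θ₀ δ ⊆ Θ) (hsep : ∀ k, θ₀ k ≠ 0 → δ ≤ |θ₀ k|)
    (hr : r = (K + 1) / a) (hrq : r + 1 ≤ q * δ / 2) (hlam : 0 < lam)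
    (hlam_le : lam * (2 * Fintype.card (Coef m) / δ) ≤ q)
    (hlam_lt : K * (2 * K * (r + 1) + b * (r + 1) ^ 2) < lam * a)
    (hmle : IsMLE M v Θ x mle) (hest : IsRMLE M v Θ mle lam x est) :
    activeSet est = activeSet θ₀ ∧
      logLik M v θ₀ x - K * r - b * r ^ 2 ≤ logLik M v est x := by
  have hr0 : 0 < r := by rw [hr]; positivity
  have har : a * r = K + 1 := by rw [hr]; field_simp
  have haqδ : 2 * (K + 1) < a * q * δ := by nlinarith
  have hKq : K * q ≤ a * q ^ 2 * δ := by nlinarith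
  -- the maximum likelihood estimator
  obtain ⟨hmleΘ, hmax⟩ := hmle (hf.exists_isMaxOn hδ hKq hΘ)
  have hθ₀Θ : θ₀ ∈ Θ := hΘ (Metric.mem_closedBall_self hδ.le)
  have hmle_norm : ‖mle - θ₀‖ ≤ K / (a * q) := by
    have h := hf.norm_sub_le (s := 0) hδ ha hq (by linarith) (by linarith) (θ := mle) (by
      have : logLik M v θ₀ x ≤ logLik M v mle x := hmax hθ₀Θ
      simpa using this)
    simpa using h
  have hcoord : ∀ (t : Coef m → ℝ) k, |t k - θ₀ k| ≤ ‖t - θ₀‖ := fun t k => by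
    simpa using norm_le_pi_norm (t - θ₀) k
  have hmle_half : K / (a * q) ≤ δ / 2 := by
    rw [div_le_div_iff₀ (by positivity) two_pos]
    linarith
  have hmle_lb : ∀ k, θ₀ k ≠ 0 → |θ₀ k| ≤ 2 * |mle k| ∧ δ / 2 ≤ |mle k| := by
    intro k hk
    have h1 := (hcoord mle k).trans (hmle_norm.trans hmle_half)
    have h2 := hsep k hk
    have h3 := abs_sub_abs_le_abs_sub (θ₀ k) (mle k)
    rw [abs_sub_comm] at h3
    constructor <;> linarith
  have hmle_zero : ∀ k, mle k = 0 → θ₀ k = 0 := by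
    intro k hk
    by_contra h
    have := (hmle_lb k h).2
    rw [hk, abs_zero] at this
    linarith
  -- the penalized estimator exists
  have hpen₀ : ∑ k, |θ₀ k| / |mle k| ≤ 2 * Fintype.card (Coef m) := by
    calc ∑ k, |θ₀ k| / |mle k| ≤ ∑ _k : Coef m, (2 : ℝ) := by
          refine Finset.sum_le_sum fun k _ => ?_
          by_cases hk : θ₀ k = 0
          · simp [hk]
          · have h := hmle_lb k hk
            exact (div_le_iff₀ (by linarith)).2 h.1
      _ = _ := by simp [mul_comm]
  have hlam_card : lam * (2 * Fintype.card (Coef m)) ≤ q * δ := by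
    rwa [← mul_div_assoc, div_le_iff₀ hδ] at hlam_le
  have hfar : ∀ θ, δ ≤ ‖θ - θ₀‖ →
      logLik M v θ x ≤ logLik M v θ₀ x - lam * ∑ k, |θ₀ k| / |mle k| := by
    intro θ hθ
    have h1 := hf.le_of_le_norm hδ hθ
    have h2 := (mul_le_mul_of_nonneg_left hpen₀ hlam.le).trans hlam_card
    have h3 : q ≤ a * q ^ 2 * δ - K * q := by nlinarith
    have h4 : δ * q ≤ ‖θ - θ₀‖ * (a * q ^ 2 * δ - K * q) :=
      mul_le_mul hθ h3 hq.le (norm_nonneg _)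
    linarith
  obtain ⟨hestΘ, hmin⟩ :=
    hest (exists_isMinOn_penalizedCriterion M v x hδ hΘ hlam hmle_zero hfar)
  have hest_supp : ∀ k, mle k = 0 → est k = 0 := by
    intro k hk
    by_contra h
    have h1 : penalizedCriterion M v mle lam x est ≤ penalizedCriterion M v mle lam x θ₀ :=
      hmin hθ₀Θ
    rw [penalizedCriterion_eq_top M v hlam x hk h,
      penalizedCriterion_eq_coe M v lam x hmle_zero] at h1
    exact EReal.coe_ne_top _ (top_le_iff.1 h1)
  have hmin_real : ∀ θ ∈ Θ, (∀ k, mle k = 0 → θ k = 0) →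
      -logLik M v est x + lam * ∑ k, |est k| / |mle k|
        ≤ -logLik M v θ x + lam * ∑ k, |θ k| / |mle k| := by
    intro θ hθ hsupp
    have h1 : penalizedCriterion M v mle lam x est ≤ penalizedCriterion M v mle lam x θ :=
      hmin hθ
    rwa [penalizedCriterion_eq_coe M v lam x hest_supp,
      penalizedCriterion_eq_coe M v lam x hsupp, EReal.coe_le_coe_iff] at h1
  -- its rate: only the coordinates in the true active set can lower the penalty
  have hest_norm : ‖est - θ₀‖ ≤ r / q := by
    have h1 := hmin_real θ₀ hθ₀Θ hmle_zero
    have h2 : ∑ k, |θ₀ k| / |mle k| - ∑ k, |est k| / |mle k|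
        ≤ Fintype.card (Coef m) * (2 / δ * ‖est - θ₀‖) := by
      rw [← Finset.sum_sub_distrib, ← nsmul_eq_mul, ← Finset.card_univ]
      refine Finset.sum_le_card_nsmul _ _ _ fun k _ => ?_
      by_cases hk : θ₀ k = 0
      · rw [hk, abs_zero, zero_div, zero_sub]
        have h3 : 0 ≤ |est k| / |mle k| := by positivity
        have h4 : 0 ≤ 2 / δ * ‖est - θ₀‖ := by positivity
        linarith
      · have h3 := (hmle_lb k hk).2
        have h4 := abs_sub_abs_le_abs_sub (θ₀ k) (est k)
        rw [abs_sub_comm] at h4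
        rw [← sub_div, div_le_iff₀ (by linarith)]
        calc |θ₀ k| - |est k| ≤ ‖est - θ₀‖ := h4.trans (hcoord est k)
          _ = 2 / δ * ‖est - θ₀‖ * (δ / 2) := by field_simp
          _ ≤ _ := by gcongr
    have h3 := mul_le_mul_of_nonneg_left h2 hlam.le
    have h4 : lam * (Fintype.card (Coef m) * (2 / δ * ‖est - θ₀‖)) ≤ q * ‖est - θ₀‖ := by
      calc lam * (Fintype.card (Coef m) * (2 / δ * ‖est - θ₀‖))
          = lam * (2 * Fintype.card (Coef m) / δ) * ‖est - θ₀‖ := by ring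
        _ ≤ _ := by gcongr
    have h5 := hf.norm_sub_le (s := 1) hδ ha hq (by linarith) (by linarith) (θ := est) (by
      linarith)
    rwa [← div_div, ← hr] at h5
  have hrqδ : r / q ≤ δ / 2 := by
    rw [div_le_iff₀ hq]
    linarith
  refine ⟨?_, ?_⟩
  · ext k
    simp only [activeSet, Finset.mem_filter, Finset.mem_univ, true_and]
    constructor
    · -- a false positive could be set to zero at a gain
      intro hk hk₀
      have hmk : mle k ≠ 0 := fun h => hk (hest_supp k h)
      set θ := Function.update est k 0 with hθ
      have hθ_norm : ‖θ - θ₀‖ ≤ r / q := by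
        refine le_trans ((pi_norm_le_iff_of_nonneg (norm_nonneg _)).2 fun j => ?_) hest_norm
        by_cases hj : j = k
        · subst hj
          simp [hθ, hk₀]
        · rw [Pi.sub_apply, hθ, Function.update_of_ne hj]
          exact hcoord est j
      have hθΘ : θ ∈ Θ := hΘ (mem_closedBall_iff_norm.2 (by linarith))
      have hθ_supp : ∀ j, mle j = 0 → θ j = 0 := by
        intro j hj
        by_cases h : j = k
        · subst h; simp [hθ]
        · rw [hθ, Function.update_of_ne h]
          exact hest_supp j hj
      have h1 := hmin_real θ hθΘ hθ_supp
      have h2 : ∑ j, |est j| / |mle j| = |est k| / |mle k| + ∑ j, |θ j| / |mle j| := by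
        rw [← Finset.add_sum_erase _ _ (Finset.mem_univ k),
          ← Finset.add_sum_erase _ (fun j => |θ j| / |mle j|) (Finset.mem_univ k)]
        have h3 : ∀ j ∈ Finset.univ.erase k, |θ j| / |mle j| = |est j| / |mle j| := by
          intro j hj
          rw [hθ, Function.update_of_ne (Finset.ne_of_mem_erase hj)]
        rw [Finset.sum_congr rfl h3]
        simp [hθ]
      have h3 := hf.le_update_add hK.le hb ha.le hq (by linarith) k 0 hθ_norm
      rw [sub_zero] at h3
      rw [← hθ] at h3
      set S := 2 * K * (r + 1) + b * (r + 1) ^ 2 with hS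
      have h4 : lam * (|est k| / |mle k|) ≤ |est k| * q * S := by
        rw [h2] at h1
        linarith
      have h5 : |mle k| ≤ K / (a * q) := by
        have := (hcoord mle k).trans hmle_norm
        rwa [hk₀, sub_zero] at this
      have hek : 0 < |est k| := abs_pos.2 hk
      have hmk' : 0 < |mle k| := abs_pos.2 hmk
      have h6 : lam ≤ q * S * |mle k| := by
        rw [← mul_div_assoc, div_le_iff₀ hmk'] at h4
        refine le_of_mul_le_mul_left (le_trans (le_of_eq (mul_comm _ _)) (h4.trans_eq ?_)) hek
        ring
      have hS0 : 0 ≤ S := by positivity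
      have h7 : q * S * |mle k| ≤ q * S * (K / (a * q)) := by gcongr
      have h8 : q * S * (K / (a * q)) * a = K * S := by field_simp
      nlinarith
    · intro hk h
      have h1 := (hcoord est k).trans (hest_norm.trans hrqδ)
      rw [h, zero_sub, abs_neg] at h1
      linarith [hsep k hk]
  · have h1 := hf.lower est
    have h2 : q * ‖est - θ₀‖ ≤ r := by
      rw [le_div_iff₀ hq] at hest_norm
      linarith
    have h3 : q ^ 2 * ‖est - θ₀‖ ^ 2 ≤ r ^ 2 := by
      rw [← mul_pow]
      exact pow_le_pow_left₀ (by positivity) h2 2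
    have h4 := mul_le_mul_of_nonneg_left h2 hK.le
    have h5 := mul_le_mul_of_nonneg_left h3 hb
    linarith

end Penalty

/-! ### Comparison of the information criterion -/

section Selection
variable {m : ℕ} (M : FeatureGroups m) {n : ℕ} (v : Fin n → M.NodeFeatures)

/-- On the event that the score at `θ₀` is at most `K √N`, the moment and information bounds pinch
the log-likelihood at scale `1 / √N`. The radius is small enough for the cubic error to absorb at
most half of the information. -/
lemma isPinchedConcave_logLik {θ₀ : Coef m → ℝ} {c B K δ : ℝ} {x : Network n}
    (hN : 0 < numDyads n) (hB : ∑ e, dyadBound M v e ^ 3 ≤ B * numDyads n) (hB0 : 0 < B)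
    (hinfo : ∀ u : Coef m → ℝ, c * (u ⬝ᵥ u) ≤ u ⬝ᵥ (fisherInfo M v θ₀).mulVec u) (hc : 0 < c)
    (hδ : δ ≤ c / (32 * B))
    (hx : ∀ k, |networkScore M v θ₀ x k| ≤ K * Real.sqrt (numDyads n)) :
    IsPinchedConcave (fun θ => logLik M v θ x) θ₀ (Fintype.card (Coef m) * K)
      (Real.sqrt (numDyads n)) (c / 4) (4 * B) δ := by
  have hsq : Real.sqrt (numDyads n) ^ 2 = numDyads n := Real.sq_sqrt hN.le
  have hlin : ∀ h : Coef m → ℝ, |h ⬝ᵥ networkScore M v θ₀ x|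
      ≤ Fintype.card (Coef m) * K * Real.sqrt (numDyads n) * ‖h‖ := by
    intro h
    refine (abs_dotProduct_le _ _).trans ?_
    rw [mul_comm _ ‖h‖, mul_assoc (Fintype.card (Coef m) : ℝ)]
    refine mul_le_mul_of_nonneg_left ?_ (norm_nonneg h)
    rw [← nsmul_eq_mul, ← Finset.card_univ]
    exact Finset.sum_le_card_nsmul _ _ _ fun k _ => hx k
  refine ⟨continuous_logLik M v x, fun θ => ⟨networkScore M v θ x, fun h =>
    logLik_add_le M v θ h x⟩, fun θ hθ => ?_, fun θ => ?_⟩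
  · have h1 := logLik_add M v θ₀ (θ - θ₀) x
    rw [add_sub_cancel] at h1
    set h := θ - θ₀
    have h2 := (abs_le.1 (hlin h)).2
    have h3 := le_likelihoodGap M v hN θ₀ h
    have h4 : ‖h‖ ^ 2 ≤ h ⬝ᵥ h := by
      have hnn : 0 ≤ h ⬝ᵥ h := Finset.sum_nonneg fun k _ => mul_self_nonneg _
      have : ‖h‖ ≤ Real.sqrt (h ⬝ᵥ h) := by
        refine (pi_norm_le_iff_of_nonneg (Real.sqrt_nonneg _)).2 fun k => ?_
        refine Real.abs_le_sqrt ?_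
        rw [sq]
        exact Finset.single_le_sum (f := fun k => h k * h k)
          (fun k _ => mul_self_nonneg _) (Finset.mem_univ k)
      calc ‖h‖ ^ 2 ≤ Real.sqrt (h ⬝ᵥ h) ^ 2 := pow_le_pow_left₀ (norm_nonneg _) this 2
        _ = _ := Real.sq_sqrt hnn
    have h5 := mul_le_mul_of_nonneg_left
      ((mul_le_mul_of_nonneg_left h4 hc.le).trans (hinfo h)) hN.le
    have h6 : 8 * ‖h‖ ^ 3 * ∑ e, dyadBound M v e ^ 3 ≤ numDyads n * (c / 4 * ‖h‖ ^ 2) := by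
      have h7 : 32 * B * ‖h‖ ≤ c := by
        have := hθ.trans hδ
        rw [le_div_iff₀ (by positivity)] at this
        linarith
      calc 8 * ‖h‖ ^ 3 * ∑ e, dyadBound M v e ^ 3 ≤ 8 * ‖h‖ ^ 3 * (B * numDyads n) := by gcongr
        _ = numDyads n * (‖h‖ ^ 2 / 4 * (32 * B * ‖h‖)) := by ring
        _ ≤ numDyads n * (‖h‖ ^ 2 / 4 * c) := by gcongr
        _ = _ := by ring
    rw [hsq]
    show logLik M v θ x ≤ logLik M v θ₀ x + _ - _
    linarith
  · have h1 := logLik_add M v θ₀ (θ - θ₀) x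
    rw [add_sub_cancel] at h1
    set h := θ - θ₀
    have h2 := (abs_le.1 (hlin h)).1
    have h3 := likelihoodGap_le M v θ₀ h
    have h4 : 4 * ‖h‖ ^ 2 * ∑ e, dyadBound M v e ^ 3 ≤ 4 * ‖h‖ ^ 2 * (B * numDyads n) := by
      gcongr
    rw [hsq]
    show logLik M v θ₀ x - _ - _ ≤ logLik M v θ x
    linarith

/-- An underfitted model loses order `N` in likelihood and hence `√N` in the criterion, more than
the whole degrees-of-freedom term; an overfitted model gains only a constant in likelihood, but
pays at least `log N` more. -/
lemma nbic_add_one_le {θ₀ : Coef m → ℝ} {est : ℝ → Coef m → ℝ} {K a b δ r ref : ℝ}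
    {x : Network n}
    (hf : IsPinchedConcave (fun θ => logLik M v θ x) θ₀ K (Real.sqrt (numDyads n)) a b δ)
    (hK : 0 < K) (ha : 0 < a) (hb : 0 ≤ b) (hδ : 0 < δ) (hr : 0 ≤ r)
    (hq : 1 ≤ Real.sqrt (numDyads n)) (hsep : ∀ k, θ₀ k ≠ 0 → δ ≤ |θ₀ k|)
    (hact : activeSet (est ref) = activeSet θ₀)
    (href : logLik M v θ₀ x - K * r - b * r ^ 2 ≤ logLik M v (est ref) x)
    (hover : 1 + K ^ 2 / a + K * r + b * r ^ 2 ≤ Real.log (numDyads n))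
    (hunder : Fintype.card (Coef m) * Real.log (numDyads n) + K * r + b * r ^ 2 + 1
      ≤ δ * (a * Real.sqrt (numDyads n) * δ - K))
    {lam : ℝ} (hlam : lam ∈ underfit θ₀ est ∪ overfit θ₀ est) :
    nbic M v x est ref + 1 ≤ nbic M v x est lam := by
  unfold nbic
  set q := Real.sqrt (numDyads n) with hqdef
  set ell := Real.log (numDyads n) with hell
  have hq0 : 0 < q := one_pos.trans_le hq
  have hK2 : 0 ≤ K ^ 2 / a := by positivity
  have hrr : 0 ≤ K * r + b * r ^ 2 := by positivity
  have hell0 : 0 ≤ ell := by linarith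
  have hKq : K < a * q * δ := by
    by_contra h
    have h1 : δ * (a * q * δ - K) ≤ 0 :=
      mul_nonpos_of_nonneg_of_nonpos hδ.le (by linarith [not_lt.1 h])
    have h2 : 0 ≤ (Fintype.card (Coef m) : ℝ) * ell := by positivity
    linarith
  have hscale : ∀ t : ℝ, 0 ≤ t → 1 / q * t ≤ t := fun t ht =>
    mul_le_of_le_one_left ht ((div_le_one hq0).2 hq)
  have h1q : 0 ≤ 1 / q := by positivity
  have hrefq : -(1 / q) * logLik M v (est ref) x
      ≤ -(1 / q) * logLik M v θ₀ x + (K * r + b * r ^ 2) := by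
    have h1 := mul_le_mul_of_nonneg_left href h1q
    have h2 := hscale _ hrr
    linarith
  rw [hact]
  rcases hlam with hlam | hlam
  · obtain ⟨k, hk, hk'⟩ := Finset.not_subset.1 hlam
    simp only [activeSet, Finset.mem_filter, Finset.mem_univ, true_and, not_not] at hk hk'
    have hdist : δ ≤ ‖est lam - θ₀‖ := by
      have h1 : |est lam k - θ₀ k| ≤ ‖est lam - θ₀‖ := by
        simpa using norm_le_pi_norm (est lam - θ₀) k
      rw [hk', zero_sub, abs_neg] at h1
      exact (hsep k hk).trans h1
    have h1 : logLik M v (est lam) x ≤ logLik M v θ₀ x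
        + ‖est lam - θ₀‖ * (K * q - a * q ^ 2 * δ) := hf.le_of_le_norm hδ hdist
    have h2 : δ * (a * q * δ - K) ≤ ‖est lam - θ₀‖ * (a * q * δ - K) :=
      mul_le_mul_of_nonneg_right hdist (by linarith)
    have h3 : -(1 / q) * logLik M v θ₀ x + δ * (a * q * δ - K)
        ≤ -(1 / q) * logLik M v (est lam) x := by
      have h4 := mul_le_mul_of_nonneg_left h1 h1q
      have h5 : 1 / q * (logLik M v θ₀ x + ‖est lam - θ₀‖ * (K * q - a * q ^ 2 * δ))
          = 1 / q * logLik M v θ₀ x - ‖est lam - θ₀‖ * (a * q * δ - K) := by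
        field_simp
        ring
      linarith
    have h6 : ((activeSet θ₀).card : ℝ) ≤ Fintype.card (Coef m) := by
      exact_mod_cast Finset.card_le_univ _
    have h7 := mul_le_mul_of_nonneg_left h6 hell0
    have h8 : 0 ≤ ell * ((activeSet (est lam)).card : ℝ) := by positivity
    linarith
  · have hcard : ((activeSet θ₀).card : ℝ) + 1 ≤ (activeSet (est lam)).card := by
      exact_mod_cast Finset.card_lt_card (hlam.1.ssubset_of_ne hlam.2.symm)
    have h1 : logLik M v (est lam) x ≤ logLik M v θ₀ x + K ^ 2 / a :=
      hf.le_add_sq_div hδ ha (by nlinarith) (est lam)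
    have h2 := mul_le_mul_of_nonneg_left h1 h1q
    have h3 := hscale _ hK2
    have h4 := mul_le_mul_of_nonneg_left hcard hell0
    linarith

end Selection

/-! ### Consistency -/

lemma tendsto_numDyads : Tendsto numDyads atTop atTop := by
  refine tendsto_atTop_mono' atTop ?_ (tendsto_natCast_atTop_atTop (R := ℝ))
  filter_upwards [eventually_ge_atTop 3] with n hn
  have : (3 : ℝ) ≤ n := by exact_mod_cast hn
  unfold numDyads
  nlinarith

lemma eventually_log_le_mul_sqrt {ε : ℝ} (hε : 0 < ε) :
    ∀ᶠ n : ℕ in atTop, Real.log (numDyads n) ≤ ε * Real.sqrt (numDyads n) := by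
  have h := (isLittleO_log_rpow_atTop (r := 1 / 2) (by norm_num)).bound hε
  filter_upwards [tendsto_numDyads.eventually h] with n hn
  rw [← Real.sqrt_eq_rpow, Real.norm_of_nonneg (Real.sqrt_nonneg _)] at hn
  exact (le_abs_self _).trans hn

theorem exists_separation_radius {ι : Type*} [Fintype ι] {Θ : Set (ι → ℝ)} {θ₀ : ι → ℝ}
    (h : θ₀ ∈ interior Θ) {ε : ℝ} (hε : 0 < ε) :
    ∃ δ, 0 < δ ∧ δ ≤ ε ∧ Metric.closedBall θ₀ δ ⊆ Θ ∧ ∀ k, θ₀ k ≠ 0 → δ ≤ |θ₀ k| := by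
  have h1 : ∀ᶠ δ : ℝ in 𝓝[>] 0, δ ≤ ε :=
    mem_of_superset (Ioc_mem_nhdsGT hε) fun _ hx => hx.2
  have h2 : ∀ᶠ δ : ℝ in 𝓝[>] 0, ∀ k, θ₀ k ≠ 0 → δ ≤ |θ₀ k| := by
    refine eventually_all.2 fun k => ?_
    by_cases hk : θ₀ k = 0
    · simp [hk]
    · exact mem_of_superset (Ioc_mem_nhdsGT (abs_pos.2 hk)) fun _ hx _ => hx.2
  obtain ⟨ρ, hρ, hρΘ⟩ := Metric.nhds_basis_closedBall.mem_iff.1 (mem_interior_iff_mem_nhds.1 h)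
  have h3 : ∀ᶠ δ : ℝ in 𝓝[>] 0, δ ≤ ρ :=
    mem_of_superset (Ioc_mem_nhdsGT hρ) fun _ hx => hx.2
  obtain ⟨δ, ⟨⟨hδ1, hδ2⟩, hδ3⟩, hδ0⟩ := (((h1.and h2).and h3).and self_mem_nhdsWithin).exists
  exact ⟨δ, hδ0, hδ1, (Metric.closedBall_subset_closedBall hδ3).trans hρΘ, hδ2⟩

/-- For large `n`, the event that the score is at most `K √N` implies a uniform gap between the
criterion at the reference tuning parameter and at every one that selects wrongly. -/
theorem eventually_nbic_gap {m : ℕ} (M : FeatureGroups m) (v : ∀ n : ℕ, Fin n → M.NodeFeatures)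
    {Θ : Set (Coef m → ℝ)} {θ₀ : Coef m → ℝ} (hθ₀ : θ₀ ∈ interior Θ) {B c K c₁ c₂ : ℝ}
    (hB0 : 0 < B)
    (hB : ∀ᶠ n : ℕ in atTop, ∑ e, dyadBound M (v n) e ^ 3 ≤ B * numDyads n)
    (hc : 0 < c) (hinfo : ∀ᶠ n : ℕ in atTop, ∀ u : Coef m → ℝ,
      c * (u ⬝ᵥ u) ≤ u ⬝ᵥ (fisherInfo M (v n) θ₀).mulVec u)
    {mle : ∀ n : ℕ, Network n → Coef m → ℝ}
    (hmle : ∀ (n : ℕ) (x : Network n), IsMLE M (v n) Θ x (mle n x))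
    {est : ∀ n : ℕ, Network n → ℝ → Coef m → ℝ}
    (hest : ∀ (n : ℕ) (x : Network n) (lam : ℝ),
      IsRMLE M (v n) Θ (mle n x) lam x (est n x lam))
    {lamRef : ℕ → ℝ} (hc₁ : 0 < c₁) (hc₂ : 0 < c₂)
    (hlamRef : ∀ᶠ n : ℕ in atTop,
      c₁ * Real.log (numDyads n) ≤ lamRef n ∧ lamRef n ≤ c₂ * Real.log (numDyads n))
    (hK : 0 < K) :
    ∀ᶠ n : ℕ in atTop, ∀ x : Network n,
      (∀ k, |networkScore M (v n) θ₀ x k| ≤ K * Real.sqrt (numDyads n)) →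
      ∀ lam ∈ underfit θ₀ (est n x) ∪ overfit θ₀ (est n x),
        nbic M (v n) x (est n x) (lamRef n) + 1 ≤ nbic M (v n) x (est n x) lam := by
  obtain ⟨δ, hδ, hδB, hΘ, hsep⟩ :=
    exists_separation_radius hθ₀ (ε := c / (32 * B)) (by positivity)
  set p : ℝ := (Fintype.card (Coef m) : ℝ) with hp
  have hp0 : 0 < p := by
    rw [hp]
    exact_mod_cast Fintype.card_pos_iff.2 ⟨Sum.inl 0⟩
  set K' := p * K with hK'
  have hK'0 : 0 < K' := by positivity
  set r := (K' + 1) / (c / 4) with hr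
  have hr0 : 0 < r := by positivity
  set S := 2 * K' * (r + 1) + 4 * B * (r + 1) ^ 2 with hS
  set T := K' * r + 4 * B * r ^ 2 + 1 with hT
  have hsqrt : Tendsto (fun n => Real.sqrt (numDyads n)) atTop atTop :=
    Real.tendsto_sqrt_atTop.comp tendsto_numDyads
  have hlog : Tendsto (fun n => Real.log (numDyads n)) atTop atTop :=
    Real.tendsto_log_atTop.comp tendsto_numDyads
  set ε₁ := 1 / (c₂ * (2 * p / δ)) with hε₁
  have hε₁0 : 0 < ε₁ := by positivity
  set ε₂ := δ * (c / 4) * δ / (2 * p) with hε₂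
  have hε₂0 : 0 < ε₂ := by positivity
  filter_upwards [hB, hinfo, hlamRef, tendsto_numDyads.eventually_gt_atTop 0,
    hsqrt.eventually_ge_atTop 1, hsqrt.eventually_ge_atTop ((r + 1) * 2 / δ),
    hsqrt.eventually_ge_atTop (2 * (T + δ * K') / (δ * (c / 4) * δ)),
    hlog.eventually_ge_atTop (T + K' ^ 2 / (c / 4)),
    hlog.eventually_gt_atTop (K' * S / (c₁ * (c / 4))),
    eventually_log_le_mul_sqrt hε₁0, eventually_log_le_mul_sqrt hε₂0]
    with n hB hinfo hlamRef hN hq1 hq2 hq3 hl1 hl2 hl3 hl4 x hx lam hlam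
  have hf := isPinchedConcave_logLik M (v n) hN hB hB0 hinfo hc hδB hx
  rw [← hp, ← hK'] at hf
  have hq0 : 0 < Real.sqrt (numDyads n) := one_pos.trans_le hq1
  have hlam_lt : K' * S < lamRef n * (c / 4) := by
    rw [div_lt_iff₀ (by positivity)] at hl2
    have := mul_le_mul_of_nonneg_right hlamRef.1 (by positivity : 0 ≤ c / 4)
    linarith
  have hlam_pos : 0 < lamRef n := by
    have : 0 < K' * S := by positivity
    exact pos_of_mul_pos_left (this.trans hlam_lt) (by positivity)
  have hlam_le : lamRef n * (2 * p / δ) ≤ Real.sqrt (numDyads n) := by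
    calc lamRef n * (2 * p / δ)
        ≤ c₂ * (ε₁ * Real.sqrt (numDyads n)) * (2 * p / δ) := by
          gcongr
          exact hlamRef.2.trans (by gcongr)
      _ = Real.sqrt (numDyads n) := by
          rw [hε₁]
          field_simp
  obtain ⟨hact, href⟩ := activeSet_eq_and_le_logLik M (v n) hf hK'0 (by positivity)
    (by positivity) hδ hq0 hΘ hsep hr (by rw [div_le_iff₀ hδ] at hq2; linarith) hlam_pos hlam_le
    hlam_lt (hmle n x) (hest n x (lamRef n))
  refine nbic_add_one_le M (v n) hf hK'0 (by positivity) (by positivity) hδ hr0.le hq1 hsep hact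
    href (by linarith) ?_ hlam
  rw [div_le_iff₀ (by positivity)] at hq3
  have h1 := mul_le_mul_of_nonneg_left hl4 hp0.le
  have h2 : p * (ε₂ * Real.sqrt (numDyads n))
      = Real.sqrt (numDyads n) * (δ * (c / 4) * δ) / 2 := by
    rw [hε₂]
    field_simp
  rw [← hp]
  linarith

/-- Convergence of probabilities from events of probability at least `1 - A / K ^ 2`. -/
lemma tendsto_one_of_eventually_one_sub_le {f : ℕ → ℝ} {A : ℝ} (hf1 : ∀ n, f n ≤ 1)
    (hf : ∀ K : ℝ, 0 < K → ∀ᶠ n in atTop, 1 - A / K ^ 2 ≤ f n) : Tendsto f atTop (𝓝 1) := by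
  refine tendsto_order.2 ⟨fun a ha => ?_, fun a ha => Eventually.of_forall fun n =>
    (hf1 n).trans_lt ha⟩
  have h : Tendsto (fun K : ℝ => 1 - A / K ^ 2) atTop (𝓝 (1 - 0)) :=
    tendsto_const_nhds.sub (tendsto_const_nhds.div_atTop (tendsto_pow_atTop two_ne_zero))
  rw [sub_zero] at h
  obtain ⟨K, hK, hK0⟩ := ((h.eventually_const_lt ha).and (eventually_gt_atTop 0)).exists
  exact (hf K hK0).mono fun n hn => hK.trans_le hn

theorem theorem3 {m : ℕ} (M : FeatureGroups m) (v : ∀ n : ℕ, Fin n → M.NodeFeatures)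
    (Θ : Set (Coef m → ℝ)) (θ₀ : Coef m → ℝ) (hθ₀ : θ₀ ∈ interior Θ)
    (hmoment : ∃ C : ℝ, ∀ᶠ n : ℕ in atTop, thirdMoment M (v n) ≤ C * numDyads n)
    (hinfo : ∃ c : ℝ, 0 < c ∧ ∀ᶠ n : ℕ in atTop, ∀ u : Coef m → ℝ,
      c * (u ⬝ᵥ u) ≤ u ⬝ᵥ (fisherInfo M (v n) θ₀).mulVec u)
    (mle : ∀ n : ℕ, Network n → Coef m → ℝ)
    (hmle : ∀ (n : ℕ) (x : Network n), IsMLE M (v n) Θ x (mle n x))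
    (est : ∀ n : ℕ, Network n → ℝ → Coef m → ℝ)
    (hest : ∀ (n : ℕ) (x : Network n) (lam : ℝ),
      IsRMLE M (v n) Θ (mle n x) lam x (est n x lam))
    (lamRef : ℕ → ℝ)
    (hlamRef : ∃ c₁ c₂ : ℝ, 0 < c₁ ∧ 0 < c₂ ∧ ∀ᶠ n : ℕ in atTop,
      c₁ * Real.log (numDyads n) ≤ lamRef n ∧ lamRef n ≤ c₂ * Real.log (numDyads n)) :
    Tendsto (fun n : ℕ => eventProb M (v n) θ₀
        {x | (⨅ lam ∈ underfit θ₀ (est n x) ∪ overfit θ₀ (est n x),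
            (nbic M (v n) x (est n x) lam : EReal))
          > (nbic M (v n) x (est n x) (lamRef n) : EReal)}) atTop (𝓝 1) ∧
    Tendsto (fun n : ℕ => eventProb M (v n) θ₀
        {x | ∀ S : Set ℝ, lamRef n ∈ S →
          ∀ lamHat ∈ S, IsMinOn (nbic M (v n) x (est n x)) S lamHat →
            activeSet (est n x lamHat) = activeSet θ₀}) atTop (𝓝 1) := by
  obtain ⟨C, hC⟩ := hmoment
  obtain ⟨c, hc, hinfo⟩ := hinfo
  obtain ⟨c₁, c₂, hc₁, hc₂, hlamRef⟩ := hlamRef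
  set B := max (108 + 288 * (m : ℝ) ^ 2 * C) 1 with hBdef
  have hB0 : 0 < B := lt_max_of_lt_right one_pos
  have hB : ∀ᶠ n : ℕ in atTop, ∑ e, dyadBound M (v n) e ^ 3 ≤ B * numDyads n := by
    filter_upwards [hC, tendsto_numDyads.eventually_gt_atTop 0] with n hn hN
    exact (sum_dyadBound_pow_le M (v n) hn).trans
      (mul_le_mul_of_nonneg_right (le_max_left _ _) hN.le)
  have hgap := fun (K : ℝ) (hK : 0 < K) => eventually_nbic_gap M v hθ₀ hB0 hB hc hinfo hmle hest
    hc₁ hc₂ hlamRef hK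
  have hprob : ∀ K : ℝ, 0 < K → ∀ᶠ n : ℕ in atTop,
      1 - 4 * B * Fintype.card (Coef m) / K ^ 2 ≤ eventProb M (v n) θ₀
        {x | ∀ k, |networkScore M (v n) θ₀ x k| ≤ K * Real.sqrt (numDyads n)} := by
    intro K hK
    filter_upwards [hB, tendsto_numDyads.eventually_gt_atTop 0] with n hn hN
    exact one_sub_le_eventProb_networkScore M (v n) θ₀ hK hN hn
  constructor
  · refine tendsto_one_of_eventually_one_sub_le (A := 4 * B * Fintype.card (Coef m))
      (fun n => eventProb_le_one M (v n) θ₀ _) fun K hK => ?_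
    filter_upwards [hprob K hK, hgap K hK] with n hn hgap
    refine hn.trans (eventProb_mono M (v n) θ₀ fun x hx => ?_)
    -- the gap of `1` is uniform, so the inequality stays strict for the infimum
    refine lt_of_lt_of_le (b := ((nbic M (v n) x (est n x) (lamRef n) + 1 : ℝ) : EReal))
      (EReal.coe_lt_coe_iff.2 (lt_add_one _)) (le_iInf₂ fun lam hlam => ?_)
    exact EReal.coe_le_coe_iff.2 (hgap x hx lam hlam)
  · refine tendsto_one_of_eventually_one_sub_le (A := 4 * B * Fintype.card (Coef m))
      (fun n => eventProb_le_one M (v n) θ₀ _) fun K hK => ?_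
    filter_upwards [hprob K hK, hgap K hK] with n hn hgap
    refine hn.trans (eventProb_mono M (v n) θ₀ fun x hx S hS lamHat _ hmin => ?_)
    by_contra hne
    have h1 : nbic M (v n) x (est n x) lamHat ≤ nbic M (v n) x (est n x) (lamRef n) := hmin hS
    have h2 := hgap x hx lamHat (by
      by_cases h : activeSet θ₀ ⊆ activeSet (est n x lamHat)
      · exact Or.inr ⟨h, hne⟩
      · exact Or.inl h)
    linarith
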